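/- Let $\mathcal A$ be the generator of a Markov semigroup on $\mathbb R^N$, let $0\le\varphi\in L^1(\mathbb R^N)$, and let $v\ge 0$ be a solution of $\partial_t v=\mathcal A v$ in $\mathbb R^N\times(0,\infty)$ with $v(\cdot,0)=\varphi$. Let $0\le \mathbf k\in L^1_{loc}([0,\infty))$ be a kernel with finite Laplace transform $\mathcal K(\lambda)=\int_0^\infty e^{-\lambda t}\mathbf k(t)\,dt$, $\lambda>0$, and let $(S_t)_{t\ge0}$ be a subordinator (values in $[0,\infty]$, so that killing is allowed) with $\mathbb E[e^{-\lambda S_t}]=e^{-t\lambda\mathcal K(\lambda)}$ for $\lambda>0$. Let $E_t=\inf\{s\ge 0: S_s\ge t\}$ be its inverse, let $G_t(\tau)$, $t>0$, be the density of the law of $E_t$ on $(0,\infty)$, and put $$v^E(x,t)=\int_0^\infty v(x,\tau)G_t(\tau)\,d\tau,\qquad \mathbf M_t(v^E(x,t))=\frac1t\int_0^t v^E(x,s)\,ds,$$ $$\|v(x)\|_1=\int_0^\infty |v(x,\tau)|\,d\tau,\qquad \|v(x)\|_{1,\ell}=\int_0^\infty e^{-\ell\tau}v(x,\tau)\,d\tau.$$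 Fix $x\in\mathbb R^N$. Assume $v(x,\cdot)\in L^1(0,\infty)$, except in case 3 with $a>0$, where only $\|v(x)\|_{1,\sqrt{ab}}<\infty$ is assumed. Then the integral defining $v^E(x,s)$ converges for almost every $s>0$, $v^E(x,\cdot)$ is integrable on $(0,t]$ for every $t>0$, and, as $t\to\infty$: 1. ($\theta$-stable) if $\mathcal K(\lambda)=\lambda^{\theta-1}$ for all $\lambda>0$, $0<\theta<1$, then $\mathbf M_t(v^E(x,t))\sim \dfrac{\|v(x)\|_1}{\Gamma(2-\theta)}\,t^{-\theta}$; 2. (distributed order) if $\mathcal K(\lambda)\sim C\lambda^{-1}(-\ln\lambda)^{-\kappa}$ as $\lambda\to0^+$, $C,\kappa>0$, then $\mathbf M_t(v^E(x,t))\sim C\,\|v(x)\|_1(\ln t)^{-\kappa}$; 3. (inverse Gamma) if $\mathcal K(\lambda)=\frac{\sqrt b}{\lambda}\left(2\sqrt{2\lambda+a}-\sqrt a\right)$ for all $\lambda>0$, $a\ge0$, $b>0$, then $\mathbf M_t(v^E(x,t))\sim \sqrt{ab}\,\|v(x)\|_{1,\sqrt{ab}}$ when $a>0$, and $\mathbf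 M_t(v^E(x,t))\sim \dfrac{2\sqrt{2b}\,\|v(x)\|_1}{\Gamma(3/2)}\,t^{-1/2}$ when $a=0$; 4. (Gamma) if $\mathcal K(\lambda)=\frac a\lambda\ln\left(1+\frac\lambda b\right)$ for all $\lambda>0$, $a,b>0$, then $\mathbf M_t(v^E(x,t))\sim \dfrac ab\,\|v(x)\|_1\,t^{-1}$; 5. (tempered stable) if $\mathcal K(\lambda)=\frac{(\lambda+\beta)^\theta-\beta^\theta}{\lambda}$ for all $\lambda>0$, $0<\theta<1$, $\beta>0$, then $\mathbf M_t(v^E(x,t))\sim \theta\beta^{\theta-1}\|v(x)\|_1\,t^{-1}$. Here $f\sim g$ means $f-g=o(g)$, i.e. $f/g\to1$ when $g\neq0$ (and $f=0$ eventually when $g=0$). -/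

import Mathlib

open MeasureTheory ProbabilityTheory Filter Topology Asymptotics Set
open scoped ENNReal NNReal

noncomputable section

namespace Subord

/-- A conservative Markov semigroup on `X`, given by its transition kernels `p_t(x, dy)`: the
Chapman-Kolmogorov equations hold and the semigroup is stochastically continuous at time `0`. -/
structure MarkovSemigroup (X : Type*) [TopologicalSpace X] [MeasurableSpace X] where
  kernel : ℝ≥0 → Kernel X X
  isMarkov : ∀ t, IsMarkovKernel (kernel t)
  zero : kernel 0 = Kernel.id
  add : ∀ s t, kernel (s + t) = kernel t ∘ₖ kernel s
  stochContinuous : ∀ (x : X) (f : BoundedContinuousFunction X ℝ),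
    Tendsto (fun t => ∫ y, f y ∂(kernel t x)) (𝓝 0) (𝓝 (f x))

/-- The graph of the (pointwise) generator `𝒜` of a Markov semigroup: `f` belongs to the domain of
`𝒜` and `𝒜 f = g`, that is, `g x = lim_{h → 0+} (P_h f (x) - f x) / h` for every `x`. A pair in the
graph of the generator in uniform norm is also in this graph. -/
structure MarkovSemigroup.GeneratorGraph {X : Type*} [TopologicalSpace X] [MeasurableSpace X]
    (P : MarkovSemigroup X) (f g : X → ℝ) : Prop where
  measurable : Measurable f
  integrable : ∀ x, ∀ᶠ h in 𝓝[>] (0 : ℝ≥0), Integrable f (P.kernel h x)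
  tendsto : ∀ x, Tendsto (fun h : ℝ≥0 => (∫ y, f y ∂(P.kernel h x) - f x) / (h : ℝ))
    (𝓝[>] 0) (𝓝 (g x))

/-- `v` solves the Cauchy problem `∂ₜ v(x,t) = (𝒜 v(·,t))(x)` for `t > 0`, `v(x,0) = φ(x)`, where
`𝒜` is the generator of `P`. The initial datum is attained locally in measure as `t → 0+` (this
follows from convergence in `L¹`, and also from convergence almost everywhere). -/
structure IsSolution {N : ℕ} (P : MarkovSemigroup (EuclideanSpace ℝ (Fin N)))
    (φ : EuclideanSpace ℝ (Fin N) → ℝ) (v : EuclideanSpace ℝ (Fin N) → ℝ → ℝ) : Prop where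
  evolution : ∀ t, 0 < t → ∃ g : EuclideanSpace ℝ (Fin N) → ℝ,
    P.GeneratorGraph (fun x => v x t) g ∧ ∀ x, HasDerivAt (v x) (g x) t
  initial : ∀ x, v x 0 = φ x
  initial_limit : ∀ K : Set (EuclideanSpace ℝ (Fin N)), IsCompact K →
    TendstoInMeasure (volume.restrict K) (fun (t : ℝ) x => v x t) (𝓝[>] 0) φ

/-- The Laplace transform `∫₀^∞ e^{-λ t} f(t) dt`. -/
def laplace (f : ℝ → ℝ) (l : ℝ) : ℝ := ∫ t in Ioi (0 : ℝ), Real.exp (-(l * t)) * f t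

/-- A non-negative, locally integrable kernel on the half-line with a finite Laplace transform. -/
structure IsKernel (k : ℝ → ℝ) : Prop where
  nonneg : ∀ t, 0 < t → 0 ≤ k t
  locallyIntegrable : LocallyIntegrableOn k (Ici 0)
  laplace_finite : ∀ l, 0 < l →
    IntegrableOn (fun t => Real.exp (-(l * t)) * k t) (Ioi 0)

/-- A subordinator with values in `[0, ∞]`: it starts at `0`, its paths are non-decreasing and
right-continuous, and it has stationary independent increments up to its lifetime (the value `∞` is
the cemetery, so killing at an exponential time is allowed): on `{S_s < ∞}` the increment
`S_{s+h} - S_s` is independent of `σ(S_u, u ≤ s)` and distributed as `S_h`. -/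
structure IsSubordinator {Ω : Type*} [MeasurableSpace Ω] (Pr : Measure Ω)
    (S : ℝ≥0 → Ω → ℝ≥0∞) : Prop where
  measurable : ∀ t, Measurable (S t)
  zero : ∀ ω, S 0 ω = 0
  mono : ∀ ω, Monotone (fun t => S t ω)
  rightContinuous : ∀ ω t, ContinuousWithinAt (fun u => S u ω) (Ici t) t
  increments : ∀ (s h : ℝ≥0) (A : Set Ω),
    MeasurableSet[⨆ u : Iic s, MeasurableSpace.comap (S u) inferInstance] A →
    ∀ B : Set ℝ≥0∞, MeasurableSet B →
      Pr (A ∩ {ω | S s ω < ∞} ∩ {ω | S (s + h) ω - S s ω ∈ B}) =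
        Pr (A ∩ {ω | S s ω < ∞}) * Pr {ω | S h ω ∈ B}

/-- `S` is a subordinator with kernel `k`: its Laplace exponent is `λ 𝒦(λ)`, i.e.
`𝔼[e^{-λ S_t}] = e^{-t λ 𝒦(λ)}` with `𝒦` the Laplace transform of `k` (and `e^{-λ ∞} = 0`).
Hence `k` is the tail `t ↦ σ((t, ∞))` of the Lévy measure, plus the killing rate if there is
killing. -/
structure IsSubordinatorOf {Ω : Type*} [MeasurableSpace Ω] (Pr : Measure Ω)
    (S : ℝ≥0 → Ω → ℝ≥0∞) (k : ℝ → ℝ) : Prop extends IsSubordinator Pr S where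
  laplaceExponent : ∀ (t : ℝ≥0) (l : ℝ), 0 < l →
    ∫ ω, (if S t ω = ∞ then 0 else Real.exp (-(l * (S t ω).toReal))) ∂Pr =
      Real.exp (-((t : ℝ) * (l * laplace k l)))

/-- The inverse process `E_t = inf {s ≥ 0 : S_s ≥ t}` (with `inf ∅ = ∞`). -/
def inverseProcess {Ω : Type*} (S : ℝ≥0 → Ω → ℝ≥0∞) (t : ℝ) (ω : Ω) : ℝ≥0∞ :=
  ⨅ (s : ℝ≥0) (_ : ENNReal.ofReal t ≤ S s ω), (s : ℝ≥0∞)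

/-- For every `t > 0`, `τ ↦ G t τ` is the density of `E_t` on `(0, ∞)`, that is
`Pr(E_t ≤ τ) = ∫₀^τ G_t(u) du`. -/
structure IsInverseDensity {Ω : Type*} [MeasurableSpace Ω] (Pr : Measure Ω)
    (S : ℝ≥0 → Ω → ℝ≥0∞) (G : ℝ → ℝ → ℝ) : Prop where
  measurable : ∀ t, 0 < t → Measurable (G t)
  nonneg : ∀ t, 0 < t → ∀ τ, 0 < τ → 0 ≤ G t τ
  density : ∀ t, 0 < t → ∀ τ, 0 ≤ τ →
    Pr {ω | inverseProcess S t ω ≤ ENNReal.ofReal τ} =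
      ∫⁻ u in Ioc 0 τ, ENNReal.ofReal (G t u)

/-- The subordination `f^E(t) = ∫₀^∞ f(τ) G_t(τ) dτ` of a function of time. -/
def subordination (f : ℝ → ℝ) (G : ℝ → ℝ → ℝ) (t : ℝ) : ℝ :=
  ∫ τ in Ioi (0 : ℝ), f τ * G t τ

/-- The integrals in the subordination and in its Cesàro mean converge: `f G_s` is integrable for
almost every `s > 0`, and `f^E` is integrable on every `(0, t]`. -/
def SubordinationConverges (f : ℝ → ℝ) (G : ℝ → ℝ → ℝ) : Prop :=
  (∀ᵐ s ∂(volume.restrict (Ioi (0 : ℝ))), IntegrableOn (fun τ => f τ * G s τ) (Ioi 0)) ∧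
    ∀ t, 0 < t → IntegrableOn (subordination f G) (Ioc 0 t)

/-- The Cesàro mean `M_t(f) = (1/t) ∫₀^t f(s) ds`. -/
def cesaroMean (f : ℝ → ℝ) (t : ℝ) : ℝ := 1 / t * ∫ s in (0 : ℝ)..t, f s

/-- The norm of `L¹(0, ∞)`. -/
def norm1 (f : ℝ → ℝ) : ℝ := ∫ τ in Ioi (0 : ℝ), |f τ|

/-- The exponentially weighted integral `∫₀^∞ e^{-ℓ τ} f(τ) dτ`. -/
def weightedNorm1 (l : ℝ) (f : ℝ → ℝ) : ℝ := ∫ τ in Ioi (0 : ℝ), Real.exp (-(l * τ)) * f τ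

/-- The `θ`-stable class. -/
def StableClass (θ : ℝ) (k : ℝ → ℝ) : Prop :=
  ∀ l, 0 < l → laplace k l = l ^ (θ - 1)

/-- The distributed order class. -/
def DistributedOrderClass (C κ : ℝ) (k : ℝ → ℝ) : Prop :=
  laplace k ~[𝓝[>] 0] fun l => C * l⁻¹ * (-Real.log l) ^ (-κ)

/-- The inverse Gamma class. -/
def InverseGammaClass (a b : ℝ) (k : ℝ → ℝ) : Prop :=
  ∀ l, 0 < l → laplace k l = √b / l * (2 * √(2 * l + a) - √a)

/-- The Gamma class. -/
def GammaClass (a b : ℝ) (k : ℝ → ℝ) : Prop :=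
  ∀ l, 0 < l → laplace k l = a / l * Real.log (1 + l / b)

/-- The tempered stable class. -/
def TemperedStableClass (θ β : ℝ) (k : ℝ → ℝ) : Prop :=
  ∀ l, 0 < l → laplace k l = ((l + β) ^ θ - β ^ θ) / l

end Subord

end

/-!
Write `f = v x` and `𝒦 = laplace k`. The paths of `S` are monotone and right-continuous, so
`{E_t ≤ τ} = {S_τ ≥ t}`. By Tonelli's theorem
`∫₀^∞ e^{-lt} Pr(E_t ≤ τ) dt = (1 - 𝔼 e^{-l S_τ}) / l = (1 - e^{-τ l 𝒦(l)}) / l`, that is, the law of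
`E_t` averaged with weight `e^{-lt}` has density `𝒦(l) e^{-l 𝒦(l) τ}`
(`IsInverseDensity.bind_inverseLaw`). Integrating `f` gives
`𝓛[f^E](l) = 𝒦(l) 𝓛[f](l 𝒦(l))` (`IsInverseDensity.laplace_subordination`), and the finiteness of
the right-hand side gives the convergence of all integrals involved.

As `l → 0+`, in every class `l 𝒦(l)` tends from above to some `p ≥ 0`, with `p = √(ab)` in the
inverse Gamma class and `p = 0` in the others, so `𝓛[f^E](l) ~ 𝒦(l) 𝓛[f](p)`, and `𝓛[f](p)` is the
norm in the claim. Since `f^E ≥ 0`, Tauberian theorems turn this into the behaviour of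
`∫₀^t f^E`. When `𝒦` is regularly varying of index `-ρ < 0`, this is Karamata's theorem
(`tendsto_integral_of_tendsto_laplace`), proved by polynomial approximation in the variable
`e^{-lt}` and a continuous cutoff of the indicator of `t ≤ 1 / l`. When `𝒦` has a finite limit at
`0`, bounding the truncated integrals suffices (`tendsto_integral_of_tendsto_laplace_zero`).
-/

namespace Subord

/-! ### Karamata's Tauberian theorem for non-negative densities -/

/-- The integral `∫₀^∞ H(e^{-lt}) e^{-lt} g(t) dt`, in which `H` is a test function on `[0, 1]`.
The monomial `H(y) = y ^ n` gives the Laplace transform of `g` at `(n + 1) l`. -/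
noncomputable def laplaceTest (g H : ℝ → ℝ) (l : ℝ) : ℝ :=
  ∫ t in Ioi (0 : ℝ), H (Real.exp (-(l * t))) * (Real.exp (-(l * t)) * g t)

lemma exp_neg_mem_Icc {l t : ℝ} (hl : 0 < l) (ht : 0 < t) :
    Real.exp (-(l * t)) ∈ Icc (0 : ℝ) 1 :=
  ⟨(Real.exp_pos _).le, Real.exp_le_one_iff.2 (by have := mul_pos hl ht; linarith)⟩

lemma integrableOn_laplaceTest {g H : ℝ → ℝ} {l : ℝ} (hl : 0 < l)
    (hg : IntegrableOn (fun t => Real.exp (-(l * t)) * g t) (Ioi 0)) (hH : Continuous H) :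
    IntegrableOn (fun t => H (Real.exp (-(l * t))) * (Real.exp (-(l * t)) * g t)) (Ioi 0) := by
  obtain ⟨C, hC⟩ := (isCompact_Icc (a := (0 : ℝ)) (b := 1)).exists_bound_of_continuousOn
    hH.continuousOn
  refine Integrable.bdd_mul (c := C) hg (Continuous.aestronglyMeasurable (by fun_prop)) ?_
  filter_upwards [ae_restrict_mem measurableSet_Ioi] with t ht
  exact hC _ (exp_neg_mem_Icc hl ht)

lemma laplaceTest_monomial (g : ℝ → ℝ) (n : ℕ) (a l : ℝ) :
    laplaceTest g (fun y => a * y ^ n) l = a * laplace g ((n + 1) * l) := by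
  unfold laplaceTest laplace
  rw [← integral_const_mul]
  refine integral_congr_ae (ae_of_all _ fun t => ?_)
  have : Real.exp (-((n + 1) * l * t)) = Real.exp (-(l * t)) ^ n * Real.exp (-(l * t)) := by
    rw [← Real.exp_nat_mul, ← Real.exp_add]; ring_nf
  simp only [this]; ring

lemma abs_laplaceTest_sub_le {g H p : ℝ → ℝ} {l ε : ℝ} (hl : 0 < l)
    (hg0 : ∀ t, 0 < t → 0 ≤ g t)
    (hg : IntegrableOn (fun t => Real.exp (-(l * t)) * g t) (Ioi 0)) (hH : Continuous H)
    (hp : Continuous p) (hHp : ∀ y ∈ Icc (0 : ℝ) 1, |p y - H y| < ε) :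
    |laplaceTest g p l - laplaceTest g H l| ≤ ε * laplace g l := by
  unfold laplaceTest laplace
  rw [← integral_sub (integrableOn_laplaceTest hl hg hp) (integrableOn_laplaceTest hl hg hH),
    ← integral_const_mul, ← Real.norm_eq_abs]
  refine norm_integral_le_of_norm_le (hg.const_mul ε) ?_
  filter_upwards [ae_restrict_mem measurableSet_Ioi] with t ht
  have h0 : 0 ≤ Real.exp (-(l * t)) * g t := mul_nonneg (Real.exp_pos _).le (hg0 t ht)
  rw [← sub_mul, Real.norm_eq_abs, abs_mul, abs_of_nonneg h0]
  exact mul_le_mul_of_nonneg_right (hHp _ (exp_neg_mem_Icc hl ht)).le h0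

lemma laplaceTest_add {g p q : ℝ → ℝ} {l : ℝ} (hl : 0 < l)
    (hg : IntegrableOn (fun t => Real.exp (-(l * t)) * g t) (Ioi 0))
    (hp : Continuous p) (hq : Continuous q) :
    laplaceTest g (fun y => p y + q y) l = laplaceTest g p l + laplaceTest g q l := by
  unfold laplaceTest
  rw [← integral_add (integrableOn_laplaceTest hl hg hp) (integrableOn_laplaceTest hl hg hq)]
  simp only [add_mul]

/-- By the Weierstrass approximation theorem, convergence of the normalized Laplace transforms at
all multiples `(n + 1) l` gives convergence against every continuous test function. -/
lemma tendsto_laplaceTest {g g₀ w : ℝ → ℝ} {c : ℝ}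
    (hg0 : ∀ t, 0 < t → 0 ≤ g t) (hg₀0 : ∀ t, 0 < t → 0 ≤ g₀ t)
    (hg : ∀ l, 0 < l → IntegrableOn (fun t => Real.exp (-(l * t)) * g t) (Ioi 0))
    (hg₀ : ∀ l, 0 < l → IntegrableOn (fun t => Real.exp (-(l * t)) * g₀ t) (Ioi 0))
    (hw : ∀ᶠ l in 𝓝[>] 0, 0 < w l)
    (h : ∀ n : ℕ, Tendsto (fun l => laplace g ((n + 1) * l) / w l) (𝓝[>] 0)
      (𝓝 (c * laplace g₀ (n + 1)))) {H : ℝ → ℝ} (hH : Continuous H) :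
    Tendsto (fun l => laplaceTest g H l / w l) (𝓝[>] 0) (𝓝 (c * laplaceTest g₀ H 1)) := by
  have hpos : ∀ᶠ l : ℝ in 𝓝[>] 0, 0 < l := eventually_mem_nhdsWithin
  have hpoly : ∀ p : Polynomial ℝ,
      Tendsto (fun l => laplaceTest g (fun y => p.eval y) l / w l) (𝓝[>] 0)
        (𝓝 (c * laplaceTest g₀ (fun y => p.eval y) 1)) := by
    intro p
    induction p using Polynomial.induction_on' with
    | add p q hp hq =>
      simp only [Polynomial.eval_add]
      rw [laplaceTest_add one_pos (hg₀ 1 one_pos) p.continuous q.continuous, mul_add]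
      refine (hp.add hq).congr' ?_
      filter_upwards [hpos] with l hl
      rw [laplaceTest_add hl (hg l hl) p.continuous q.continuous, add_div]
    | monomial n a =>
      simp only [Polynomial.eval_monomial, laplaceTest_monomial, mul_one]
      have := (h n).const_mul a
      convert this using 2 <;> ring
  have h1 : Tendsto (fun l => laplace g l / w l) (𝓝[>] 0) (𝓝 (c * laplace g₀ 1)) := by
    simpa using h 0
  rw [Metric.tendsto_nhds]
  intro ε hε
  set D : ℝ := |c * laplace g₀ 1| + 1 + |c| * |laplace g₀ 1| + 1 with hD
  have hDpos : 0 < D := by positivity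
  obtain ⟨p, hp⟩ := exists_polynomial_near_of_continuousOn 0 1 H hH.continuousOn (ε / (2 * D))
    (by positivity)
  have e1 := (Metric.tendsto_nhds.1 (hpoly p)) (ε / 2) (by positivity)
  have e2 := (Metric.tendsto_nhds.1 h1) 1 one_pos
  filter_upwards [hpos, hw, e1, e2] with l hl hwl e1 e2
  rw [Real.dist_eq] at e1 e2 ⊢
  have b1 := abs_laplaceTest_sub_le hl hg0 (hg l hl) hH p.continuous hp
  have b2 := abs_laplaceTest_sub_le one_pos hg₀0 (hg₀ 1 one_pos) hH p.continuous hp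
  have b1' : |laplaceTest g H l / w l - laplaceTest g (fun y => p.eval y) l / w l|
      ≤ ε / (2 * D) * (|c * laplace g₀ 1| + 1) := by
    rw [← sub_div, abs_div, abs_of_pos hwl, abs_sub_comm]
    have : laplace g l / w l ≤ |c * laplace g₀ 1| + 1 := by
      have := le_abs_self (c * laplace g₀ 1)
      have := (abs_lt.1 e2).2
      linarith
    calc _ ≤ ε / (2 * D) * laplace g l / w l := by gcongr
      _ = ε / (2 * D) * (laplace g l / w l) := by ring
      _ ≤ _ := by gcongr
  have b2' : |c * laplaceTest g₀ (fun y => p.eval y) 1 - c * laplaceTest g₀ H 1|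
      ≤ ε / (2 * D) * (|c| * |laplace g₀ 1|) := by
    rw [← mul_sub, abs_mul]
    calc _ ≤ |c| * (ε / (2 * D) * laplace g₀ 1) := by gcongr
      _ ≤ |c| * (ε / (2 * D) * |laplace g₀ 1|) := by gcongr; exact le_abs_self _
      _ = _ := by ring
  have hsum : ε / (2 * D) * (|c * laplace g₀ 1| + 1) + ε / (2 * D) * (|c| * |laplace g₀ 1|)
      < ε / 2 := by
    have : ε / 2 = ε / (2 * D) * D := by field_simp
    rw [this, ← mul_add]
    exact mul_lt_mul_of_pos_left (by rw [hD]; linarith) (by positivity)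
  have t1 := abs_sub_le (laplaceTest g H l / w l) (laplaceTest g (fun y => p.eval y) l / w l)
    (c * laplaceTest g₀ H 1)
  have t2 := abs_sub_le (laplaceTest g (fun y => p.eval y) l / w l)
    (c * laplaceTest g₀ (fun y => p.eval y) 1) (c * laplaceTest g₀ H 1)
  linarith

/-- A test function supported in `s ≤ 2`, moved to the variable `y = e^{-s}` and divided by `y`. -/
noncomputable def logTest (η : ℝ → ℝ) (y : ℝ) : ℝ :=
  η (-Real.log (max y (Real.exp (-2)))) / max y (Real.exp (-2))

lemma continuous_logTest {η : ℝ → ℝ} (hη : Continuous η) : Continuous (logTest η) := by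
  have hpos : ∀ y : ℝ, max y (Real.exp (-2)) ≠ 0 := fun y =>
    (lt_of_lt_of_le (Real.exp_pos _) (le_max_right _ _)).ne'
  unfold logTest
  refine Continuous.div (hη.comp ?_) (by fun_prop) hpos
  exact (Continuous.log (by fun_prop) hpos).neg

lemma logTest_exp {η : ℝ → ℝ} (hη : ∀ s, 2 ≤ s → η s = 0) (s : ℝ) :
    logTest η (Real.exp (-s)) * Real.exp (-s) = η s := by
  unfold logTest
  rcases le_total s 2 with hs | hs
  · rw [max_eq_left (Real.exp_le_exp.2 (by linarith)), Real.log_exp, neg_neg,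
      div_mul_cancel₀ _ (Real.exp_pos _).ne']
  · rw [max_eq_right (Real.exp_le_exp.2 (by linarith)), Real.log_exp, neg_neg, hη s hs,
      hη 2 le_rfl]
    simp

lemma laplaceTest_logTest {η : ℝ → ℝ} (hη : ∀ s, 2 ≤ s → η s = 0) (g : ℝ → ℝ) (l : ℝ) :
    laplaceTest g (logTest η) l = ∫ t in Ioi (0 : ℝ), η (l * t) * g t := by
  unfold laplaceTest
  refine integral_congr_ae (ae_of_all _ fun t => ?_)
  simp only [← mul_assoc, logTest_exp hη]

lemma integrableOn_logTest {η g : ℝ → ℝ} (hc : Continuous η) (hη : ∀ s, 2 ≤ s → η s = 0)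
    {l : ℝ} (hl : 0 < l)
    (hg : IntegrableOn (fun t => Real.exp (-(l * t)) * g t) (Ioi 0)) :
    IntegrableOn (fun t => η (l * t) * g t) (Ioi 0) := by
  refine (integrableOn_laplaceTest hl hg (continuous_logTest hc)).congr (ae_of_all _ fun t => ?_)
  simp only [← mul_assoc, logTest_exp hη]

/-- The continuous cutoff that is `1` on `s ≤ a`, `0` on `s ≥ b` and affine in between. -/
noncomputable def cutoff (a b s : ℝ) : ℝ := max 0 (min 1 ((b - s) / (b - a)))

lemma continuous_cutoff (a b : ℝ) : Continuous (cutoff a b) := by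
  unfold cutoff; fun_prop

lemma cutoff_nonneg (a b s : ℝ) : 0 ≤ cutoff a b s := le_max_left _ _

lemma cutoff_le_one (a b s : ℝ) : cutoff a b s ≤ 1 := max_le zero_le_one (min_le_left _ _)

lemma cutoff_of_le {a b s : ℝ} (hab : a < b) (hs : s ≤ a) : cutoff a b s = 1 := by
  have : 1 ≤ (b - s) / (b - a) := by rw [le_div_iff₀ (by linarith)]; linarith
  rw [cutoff, min_eq_left this, max_eq_right zero_le_one]

lemma cutoff_of_ge {a b s : ℝ} (hab : a < b) (hs : b ≤ s) : cutoff a b s = 0 := by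
  have : (b - s) / (b - a) ≤ 0 := div_nonpos_of_nonpos_of_nonneg (by linarith) (by linarith)
  rw [cutoff, max_eq_left ((min_le_right _ _).trans this)]

lemma integrableOn_Ioc_of_laplace {g : ℝ → ℝ}
    (hg : IntegrableOn (fun t => Real.exp (-(1 * t)) * g t) (Ioi 0)) (b : ℝ) :
    IntegrableOn g (Ioc 0 b) := by
  have h1 : IntegrableOn (fun t => Real.exp t * (Real.exp (-(1 * t)) * g t)) (Ioc 0 b) := by
    refine Integrable.bdd_mul (c := Real.exp b) (hg.mono_set Ioc_subset_Ioi_self)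
      (Continuous.aestronglyMeasurable (by fun_prop)) ?_
    filter_upwards [ae_restrict_mem measurableSet_Ioc] with t ht
    rw [Real.norm_eq_abs, Real.abs_exp]
    exact Real.exp_le_exp.2 ht.2
  refine h1.congr (ae_of_all _ fun t => ?_)
  simp only [← mul_assoc, ← Real.exp_add]
  simp

/-- A cutoff equal to `1` on `s ≤ a` and supported in `s ≤ b` integrates `g` to something between
the integrals of `g` over `(0, a / l]` and over `(0, b / l]`. -/
lemma integral_Ioc_le_integral_cutoff {g : ℝ → ℝ} (hg0 : ∀ t, 0 < t → 0 ≤ g t)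
    (hg : ∀ l, 0 < l → IntegrableOn (fun t => Real.exp (-(l * t)) * g t) (Ioi 0))
    {a b l : ℝ} (hab : a < b) (hb : b ≤ 2) (hl : 0 < l) :
    ∫ t in Ioc 0 (a / l), g t ≤ ∫ t in Ioi (0 : ℝ), cutoff a b (l * t) * g t := by
  rw [← integral_indicator measurableSet_Ioc, ← integral_indicator measurableSet_Ioi]
  refine integral_mono ((integrableOn_Ioc_of_laplace (hg 1 one_pos) _).integrable_indicator
    measurableSet_Ioc) ((integrableOn_logTest (continuous_cutoff a b)
      (fun s hs => cutoff_of_ge hab (hb.trans hs)) hl (hg l hl)).integrable_indicator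
      measurableSet_Ioi) fun t => ?_
  by_cases ht : 0 < t
  · rw [indicator_of_mem (mem_Ioi.2 ht)]
    by_cases hta : t ≤ a / l
    · rw [indicator_of_mem (show t ∈ Ioc 0 (a / l) from ⟨ht, hta⟩),
        cutoff_of_le hab (by rwa [mul_comm, ← le_div_iff₀ hl]), one_mul]
    · rw [indicator_of_notMem fun h => hta h.2]
      exact mul_nonneg (cutoff_nonneg _ _ _) (hg0 t ht)
  · rw [indicator_of_notMem (show t ∉ Ioc 0 (_ / l) from fun h => ht h.1),
      indicator_of_notMem (show t ∉ Ioi 0 from ht)]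

lemma integral_cutoff_le_integral_Ioc {g : ℝ → ℝ} (hg0 : ∀ t, 0 < t → 0 ≤ g t)
    (hg : ∀ l, 0 < l → IntegrableOn (fun t => Real.exp (-(l * t)) * g t) (Ioi 0))
    {a b l : ℝ} (hab : a < b) (hb : b ≤ 2) (hl : 0 < l) :
    ∫ t in Ioi (0 : ℝ), cutoff a b (l * t) * g t ≤ ∫ t in Ioc 0 (b / l), g t := by
  rw [← integral_indicator measurableSet_Ioc, ← integral_indicator measurableSet_Ioi]
  refine integral_mono ((integrableOn_logTest (continuous_cutoff a b)
      (fun s hs => cutoff_of_ge hab (hb.trans hs)) hl (hg l hl)).integrable_indicator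
      measurableSet_Ioi) ((integrableOn_Ioc_of_laplace (hg 1 one_pos) _).integrable_indicator
    measurableSet_Ioc) fun t => ?_
  by_cases ht : 0 < t
  · rw [indicator_of_mem (mem_Ioi.2 ht)]
    by_cases hta : t ≤ b / l
    · rw [indicator_of_mem (show t ∈ Ioc 0 (b / l) from ⟨ht, hta⟩)]
      exact mul_le_of_le_one_left (hg0 t ht) (cutoff_le_one _ _ _)
    · rw [indicator_of_notMem fun h => hta h.2, cutoff_of_ge hab, zero_mul]
      rw [mul_comm, ← div_le_iff₀ hl]; exact (not_le.1 hta).le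
  · rw [indicator_of_notMem (show t ∉ Ioc 0 (_ / l) from fun h => ht h.1),
      indicator_of_notMem (show t ∉ Ioi 0 from ht)]

lemma integrableOn_exp_mul_rpow {ρ : ℝ} (hρ : 0 < ρ) {l : ℝ} (hl : 0 < l) :
    IntegrableOn (fun t : ℝ => Real.exp (-(l * t)) * t ^ (ρ - 1)) (Ioi 0) := by
  have h := integrableOn_rpow_mul_exp_neg_mul_rpow (p := 1) (s := ρ - 1) (b := l)
    (by linarith) one_pos hl
  refine h.congr (ae_of_all _ fun t => ?_)
  simp only [Real.rpow_one, neg_mul]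
  ring

lemma laplace_rpow {ρ : ℝ} (hρ : 0 < ρ) {l : ℝ} (hl : 0 < l) :
    laplace (fun t => t ^ (ρ - 1)) l = l ^ (-ρ) * Real.Gamma ρ := by
  unfold laplace
  have := Real.integral_rpow_mul_exp_neg_mul_Ioi hρ hl
  rw [one_div, Real.inv_rpow hl.le, ← Real.rpow_neg hl.le] at this
  rw [← this]
  exact integral_congr_ae (ae_of_all _ fun t => mul_comm _ _)

lemma integral_Ioc_rpow {ρ : ℝ} (hρ : 0 < ρ) {b : ℝ} (hb : 0 ≤ b) :
    ∫ t in Ioc 0 b, t ^ (ρ - 1) = b ^ ρ / ρ := by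
  rw [← intervalIntegral.integral_of_le hb, integral_rpow (Or.inl (by linarith))]
  simp [hρ.ne']

/-- Karamata's Tauberian theorem for a non-negative density `g` and a positive index `ρ`: if the
Laplace transform of `g`, normalized by `w`, behaves like `c (n + 1) ^ (-ρ)` at the multiples
`(n + 1) l` as `l → 0+`, then `∫_0^{1/l} g ~ c w(l) / Γ(ρ + 1)`. -/
theorem tendsto_integral_of_tendsto_laplace {g w : ℝ → ℝ} {c ρ : ℝ} (hρ : 0 < ρ)
    (hg0 : ∀ t, 0 < t → 0 ≤ g t)
    (hg : ∀ l, 0 < l → IntegrableOn (fun t => Real.exp (-(l * t)) * g t) (Ioi 0))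
    (hw : ∀ᶠ l in 𝓝[>] 0, 0 < w l)
    (h : ∀ n : ℕ, Tendsto (fun l => laplace g ((n + 1) * l) / w l) (𝓝[>] 0)
      (𝓝 (c * ((n : ℝ) + 1) ^ (-ρ)))) :
    Tendsto (fun l => (∫ t in Ioc 0 l⁻¹, g t) / w l) (𝓝[>] 0)
      (𝓝 (c / Real.Gamma (ρ + 1))) := by
  have hΓ : 0 < Real.Gamma ρ := Real.Gamma_pos_of_pos hρ
  have hpos : ∀ᶠ l : ℝ in 𝓝[>] 0, 0 < l := eventually_mem_nhdsWithin
  have hg₀0 : ∀ t : ℝ, 0 < t → 0 ≤ t ^ (ρ - 1) := fun t ht => Real.rpow_nonneg ht.le _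
  have hc0 : 0 ≤ c := by
    have h0 := h 0
    simp only [Nat.cast_zero, zero_add, one_mul, Real.one_rpow, mul_one] at h0
    refine ge_of_tendsto h0 ?_
    filter_upwards [hw] with l hwl
    refine div_nonneg (setIntegral_nonneg measurableSet_Ioi fun t ht => ?_) hwl.le
    exact mul_nonneg (Real.exp_pos _).le (hg0 t ht)
  have key : ∀ a b : ℝ, a < b → b ≤ 2 →
      Tendsto (fun l => (∫ t in Ioi (0 : ℝ), cutoff a b (l * t) * g t) / w l) (𝓝[>] 0)
        (𝓝 (c / Real.Gamma ρ * ∫ t in Ioi (0 : ℝ), cutoff a b (1 * t) * t ^ (ρ - 1))) := by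
    intro a b hab hb
    have hη : ∀ s, 2 ≤ s → cutoff a b s = 0 := fun s hs => cutoff_of_ge hab (hb.trans hs)
    have := tendsto_laplaceTest (c := c / Real.Gamma ρ) hg0 hg₀0 hg
      (fun l hl => integrableOn_exp_mul_rpow hρ hl) hw (fun n => by
        rw [laplace_rpow hρ (by positivity)]
        convert h n using 2
        field_simp) (continuous_logTest (continuous_cutoff a b))
    simpa only [laplaceTest_logTest hη] using this
  have hG : Real.Gamma (ρ + 1) = ρ * Real.Gamma ρ := Real.Gamma_add_one hρ.ne'
  have hcont : Tendsto (fun r : ℝ => c / Real.Gamma ρ * (r ^ ρ / ρ)) (𝓝 1)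
      (𝓝 (c / Real.Gamma (ρ + 1))) := by
    have h1 : Tendsto (fun r : ℝ => r ^ ρ) (𝓝 1) (𝓝 (1 ^ ρ)) :=
      (Real.continuousAt_rpow_const 1 ρ (Or.inl one_ne_zero)).tendsto
    have := (h1.div_const ρ).const_mul (c / Real.Gamma ρ)
    convert this using 2
    rw [hG, Real.one_rpow]
    field_simp
  have hcΓ : 0 ≤ c / Real.Gamma ρ := div_nonneg hc0 hΓ.le
  rw [tendsto_order]
  constructor
  · intro x hx
    -- a cutoff below the indicator of `s ≤ 1`, equal to `1` on `s ≤ r` for some `r < 1`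
    obtain ⟨r, hr, hr0, hr1⟩ := (((hcont.mono_left nhdsWithin_le_nhds).eventually_const_lt hx).and
      (Ioo_mem_nhdsLT (zero_lt_one' ℝ))).exists
    have hlow := integral_Ioc_le_integral_cutoff hg₀0
      (fun l hl => integrableOn_exp_mul_rpow hρ hl) hr1 one_le_two one_pos
    rw [div_one, integral_Ioc_rpow hρ hr0.le] at hlow
    filter_upwards [hpos, hw, (key r 1 hr1 one_le_two).eventually_const_lt
      (hr.trans_le (mul_le_mul_of_nonneg_left hlow hcΓ))] with l hl hwl hx'
    refine hx'.trans_le (div_le_div_of_nonneg_right ?_ hwl.le)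
    simpa using integral_cutoff_le_integral_Ioc hg0 hg hr1 one_le_two hl
  · intro x hx
    -- a cutoff above the indicator of `s ≤ 1`, supported in `s ≤ r` for some `r > 1`
    obtain ⟨r, hr, hr1, hr2⟩ := (((hcont.mono_left nhdsWithin_le_nhds).eventually_lt_const hx).and
      (Ioo_mem_nhdsGT (one_lt_two (α := ℝ)))).exists
    have hup := integral_cutoff_le_integral_Ioc hg₀0
      (fun l hl => integrableOn_exp_mul_rpow hρ hl) hr1 hr2.le one_pos
    rw [div_one, integral_Ioc_rpow hρ (by linarith)] at hup
    filter_upwards [hpos, hw, (key 1 r hr1 hr2.le).eventually_lt_const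
      ((mul_le_mul_of_nonneg_left hup hcΓ).trans_lt hr)] with l hl hwl hx'
    refine lt_of_le_of_lt (div_le_div_of_nonneg_right ?_ hwl.le) hx'
    simpa using integral_Ioc_le_integral_cutoff hg0 hg hr1 hr2.le hl

/-- The Laplace transform is continuous from the right at every point where it converges. -/
lemma tendsto_laplace {ι : Type*} {F : Filter ι} [F.IsCountablyGenerated] {f : ℝ → ℝ} {p : ℝ}
    {q : ι → ℝ}
    (hf : IntegrableOn (fun t => Real.exp (-(p * t)) * f t) (Ioi 0))
    (hq : Tendsto q F (𝓝 p)) (hpq : ∀ᶠ i in F, p ≤ q i) :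
    Tendsto (fun i => laplace f (q i)) F (𝓝 (laplace f p)) := by
  have hfm : AEStronglyMeasurable f (volume.restrict (Ioi 0)) := by
    have : AEStronglyMeasurable (fun t => Real.exp (p * t) * (Real.exp (-(p * t)) * f t))
        (volume.restrict (Ioi 0)) :=
      (Continuous.aestronglyMeasurable (by fun_prop)).mul hf.aestronglyMeasurable
    refine this.congr (ae_of_all _ fun t => ?_)
    simp only [← mul_assoc, ← Real.exp_add]
    simp
  unfold laplace
  refine tendsto_integral_filter_of_dominated_convergence _ ?_ ?_ hf.norm ?_
  · exact Eventually.of_forall fun i => (Continuous.aestronglyMeasurable (by fun_prop)).mul hfm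
  · filter_upwards [hpq] with i hi
    filter_upwards [ae_restrict_mem measurableSet_Ioi] with t ht
    rw [norm_mul, norm_mul]
    refine mul_le_mul_of_nonneg_right ?_ (norm_nonneg _)
    rw [Real.norm_eq_abs, Real.norm_eq_abs, Real.abs_exp, Real.abs_exp]
    exact Real.exp_le_exp.2 (neg_le_neg (mul_le_mul_of_nonneg_right hi (mem_Ioi.1 ht).le))
  · refine ae_of_all _ fun t => ?_
    exact ((Real.continuous_exp.tendsto _).comp (hq.mul_const t).neg).mul_const _

/-- The Tauberian theorem of index `0`: a finite limit of the Laplace transform at `0` is the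
integral of the density. -/
theorem tendsto_integral_of_tendsto_laplace_zero {g : ℝ → ℝ} {c : ℝ}
    (hg0 : ∀ t, 0 < t → 0 ≤ g t)
    (hg : ∀ l, 0 < l → IntegrableOn (fun t => Real.exp (-(l * t)) * g t) (Ioi 0))
    (h : Tendsto (laplace g) (𝓝[>] 0) (𝓝 c)) :
    Tendsto (fun l => ∫ t in Ioc 0 l⁻¹, g t) (𝓝[>] 0) (𝓝 c) := by
  have hloc := integrableOn_Ioc_of_laplace (hg 1 one_pos)
  have hbound : ∀ b : ℝ, 0 ≤ b → ∫ t in Ioc 0 b, g t ≤ c := by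
    intro b hb
    have hlim : Tendsto (fun l : ℝ => Real.exp (-(l * b)) * ∫ t in Ioc 0 b, g t) (𝓝[>] 0)
        (𝓝 (Real.exp (-(0 * b)) * ∫ t in Ioc 0 b, g t)) := by
      refine Tendsto.mono_left (Continuous.tendsto ?_ 0) nhdsWithin_le_nhds
      fun_prop
    have e0 : Real.exp (-(0 * b)) * ∫ t in Ioc 0 b, g t = ∫ t in Ioc 0 b, g t := by simp
    rw [e0] at hlim
    refine le_of_tendsto_of_tendsto hlim h ?_
    filter_upwards [self_mem_nhdsWithin] with l hl
    rw [← integral_const_mul]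
    calc _ ≤ ∫ t in Ioc 0 b, Real.exp (-(l * t)) * g t := by
          refine setIntegral_mono_on ((hloc b).const_mul _)
            ((hg l hl).mono_set Ioc_subset_Ioi_self) measurableSet_Ioc fun t ht => ?_
          refine mul_le_mul_of_nonneg_right (Real.exp_le_exp.2 ?_) (hg0 t ht.1)
          exact neg_le_neg (mul_le_mul_of_nonneg_left ht.2 (mem_Ioi.1 hl).le)
      _ ≤ _ := by
          refine setIntegral_mono_set (hg l hl) ?_ Ioc_subset_Ioi_self.eventuallyLE
          filter_upwards [ae_restrict_mem measurableSet_Ioi] with t ht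
          exact mul_nonneg (Real.exp_pos _).le (hg0 t ht)
  have hint : IntegrableOn g (Ioi 0) := by
    refine integrableOn_Ioi_of_intervalIntegral_norm_bounded (l := atTop) (b := id) c 0
      (fun b => hloc b) tendsto_id ?_
    filter_upwards [eventually_ge_atTop 0] with b hb
    rw [id, intervalIntegral.integral_of_le hb]
    refine le_trans (le_of_eq (setIntegral_congr_fun measurableSet_Ioc fun t ht => ?_))
      (hbound b hb)
    exact Real.norm_of_nonneg (hg0 t ht.1)
  have hc : c = ∫ t in Ioi 0, g t := by
    have hz : IntegrableOn (fun t => Real.exp (-(0 * t)) * g t) (Ioi 0) := by simpa using hint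
    have := tendsto_laplace (F := 𝓝[>] (0 : ℝ)) (q := id) hz
      (tendsto_id.mono_left nhdsWithin_le_nhds)
      (eventually_mem_nhdsWithin.mono fun l hl => (mem_Ioi.1 hl).le)
    rw [tendsto_nhds_unique h this]
    simp [laplace]
  rw [hc]
  refine (intervalIntegral_tendsto_integral_Ioi 0 hint
    (tendsto_inv_nhdsGT_zero (𝕜 := ℝ))).congr' ?_
  filter_upwards [self_mem_nhdsWithin] with l hl
  rw [intervalIntegral.integral_of_le (inv_nonneg.2 (mem_Ioi.1 hl).le)]

/-! ### The Laplace transform of a subordinated function -/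

section InverseSubordinator

variable {Ω : Type*} [MeasurableSpace Ω] {Pr : Measure Ω} {S : ℝ≥0 → Ω → ℝ≥0∞}
  {k : ℝ → ℝ} {G : ℝ → ℝ → ℝ}

/-- The infimum defining `E_t` is attained, by right-continuity of the paths. -/
lemma IsSubordinator.inverseProcess_le_iff (hS : IsSubordinator Pr S) (t τ : ℝ)
    (ω : Ω) : inverseProcess S t ω ≤ ENNReal.ofReal τ ↔ ENNReal.ofReal t ≤ S τ.toNNReal ω := by
  constructor
  · intro h
    have hlim : Tendsto (fun u => S u ω) (𝓝[>] τ.toNNReal) (𝓝 (S τ.toNNReal ω)) :=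
      (hS.rightContinuous ω τ.toNNReal).tendsto.mono_left (nhdsWithin_mono _ Ioi_subset_Ici_self)
    refine ge_of_tendsto hlim ?_
    filter_upwards [self_mem_nhdsWithin] with u hu
    have hlt : inverseProcess S t ω < (u : ℝ≥0∞) :=
      h.trans_lt (ENNReal.coe_lt_coe.2 hu)
    simp only [inverseProcess, iInf_lt_iff] at hlt
    obtain ⟨s, hs, hsu⟩ := hlt
    exact hs.trans (hS.mono ω (ENNReal.coe_lt_coe.1 hsu).le)
  · intro h
    exact iInf₂_le (τ.toNNReal) h

lemma IsInverseDensity.lintegral_Ioc (hG : IsInverseDensity Pr S G) (hS : IsSubordinator Pr S)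
    {t τ : ℝ} (ht : 0 < t) (hτ : 0 ≤ τ) :
    ∫⁻ u in Ioc 0 τ, ENNReal.ofReal (G t u) = Pr {ω | ENNReal.ofReal t ≤ S τ.toNNReal ω} := by
  rw [← hG.density t ht τ hτ]
  simp only [hS.inverseProcess_le_iff]

/-- The law of `E_t` restricted to `(0, ∞)`, for `t > 0`, as a measure on the real line. -/
noncomputable def inverseLaw (G : ℝ → ℝ → ℝ) (t : ℝ) : Measure ℝ :=
  if 0 < t then (volume.restrict (Ioi 0)).withDensity (fun u => ENNReal.ofReal (G t u)) else 0

lemma inverseLaw_Iic_of_nonpos (t : ℝ) {x : ℝ} (hx : x ≤ 0) : inverseLaw G t (Iic x) = 0 := by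
  unfold inverseLaw
  split_ifs
  · rw [withDensity_apply _ measurableSet_Iic, Measure.restrict_restrict measurableSet_Iic,
      inter_comm, Ioi_inter_Iic, Ioc_eq_empty (not_lt.2 hx)]
    simp
  · simp

lemma IsInverseDensity.inverseLaw_Iic (hG : IsInverseDensity Pr S G) (hS : IsSubordinator Pr S)
    {t x : ℝ} (ht : 0 < t) (hx : 0 ≤ x) :
    inverseLaw G t (Iic x) = Pr {ω | ENNReal.ofReal t ≤ S x.toNNReal ω} := by
  rw [inverseLaw, if_pos ht, withDensity_apply _ measurableSet_Iic,
    Measure.restrict_restrict measurableSet_Iic, inter_comm, Ioi_inter_Iic,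
    hG.lintegral_Ioc hS ht hx]

lemma inverseLaw_univ (t : ℝ) :
    inverseLaw G t univ = ⨆ n : ℕ, inverseLaw G t (Iic (n : ℝ)) := by
  have hm : Monotone fun n : ℕ => Iic (n : ℝ) := fun a b h => Iic_subset_Iic.2 (by exact_mod_cast h)
  rw [← hm.measure_iUnion]
  congr 1
  exact (eq_univ_of_forall fun x => mem_iUnion.2 (exists_nat_ge x)).symm

lemma IsInverseDensity.inverseLaw_univ_le [IsProbabilityMeasure Pr]
    (hG : IsInverseDensity Pr S G) (hS : IsSubordinator Pr S) (t : ℝ) :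
    inverseLaw G t univ ≤ 1 := by
  by_cases ht : 0 < t
  · rw [inverseLaw_univ]
    refine iSup_le fun n => ?_
    rw [hG.inverseLaw_Iic hS ht n.cast_nonneg]
    exact prob_le_one
  · simp [inverseLaw, ht]

/-- The laws of the inverse process depend measurably on time, although `G` is only assumed to be
measurable in each section: `Pr (E_t ≤ x)` is monotone in `t`. -/
lemma IsInverseDensity.measurable_inverseLaw [IsProbabilityMeasure Pr]
    (hG : IsInverseDensity Pr S G) (hS : IsSubordinator Pr S) : Measurable (inverseLaw G) := by
  have hfin : ∀ t, IsFiniteMeasure (inverseLaw G t) := fun t =>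
    ⟨(hG.inverseLaw_univ_le hS t).trans_lt ENNReal.one_lt_top⟩
  have hIic : ∀ x, Measurable fun t => inverseLaw G t (Iic x) := by
    intro x
    rcases le_total x 0 with hx | hx
    · simp only [inverseLaw_Iic_of_nonpos _ hx, measurable_const]
    · have he : (fun t => inverseLaw G t (Iic x)) =
          fun t => if t ∈ Ioi 0 then Pr {ω | ENNReal.ofReal t ≤ S x.toNNReal ω} else 0 := by
        funext t
        by_cases ht : 0 < t
        · rw [hG.inverseLaw_Iic hS ht hx, if_pos (mem_Ioi.2 ht)]
        · simp [inverseLaw, ht]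
      rw [he]
      refine Measurable.ite measurableSet_Ioi (Antitone.measurable fun a b hab => ?_)
        measurable_const
      exact measure_mono fun ω hω => (ENNReal.ofReal_le_ofReal hab).trans hω
  refine Measurable.measure_of_isPiSystem
    ((BorelSpace.measurable_eq).trans (borel_eq_generateFrom_Iic ℝ)) isPiSystem_Iic ?_ ?_
  · rintro _ ⟨x, rfl⟩
    exact hIic x
  · simp only [inverseLaw_univ]
    exact .iSup fun n => hIic n

/-- The integral of `e^{-lt}` up to a random level `s ∈ [0, ∞]`. -/
lemma lintegral_exp_indicator {l : ℝ} (hl : 0 < l) (s : ℝ≥0∞) :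
    ∫⁻ t in Ioi (0 : ℝ), ENNReal.ofReal (Real.exp (-(l * t))) *
        {t | ENNReal.ofReal t ≤ s}.indicator 1 t =
      ENNReal.ofReal ((1 - if s = ∞ then 0 else Real.exp (-(l * s.toReal))) / l) := by
  have hderiv : ∀ t : ℝ, HasDerivAt (fun t => -(Real.exp (-(l * t)) / l))
      (Real.exp (-(l * t))) t := by
    intro t
    have h1 : HasDerivAt (fun t => -(l * t)) (-(l * 1)) t := ((hasDerivAt_id t).const_mul l).neg
    refine (h1.exp.div_const l).neg.congr_deriv ?_
    field_simp
  by_cases hs : s = ∞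
  · have hint : IntegrableOn (fun t => Real.exp (-(l * t))) (Ioi 0) := by
      simpa only [neg_mul] using exp_neg_integrableOn_Ioi 0 hl
    simp only [hs, le_top, ofPred_true, indicator_univ, Pi.one_apply, mul_one, if_true, sub_zero]
    rw [← ofReal_integral_eq_lintegral_ofReal hint (ae_of_all _ fun t => (Real.exp_pos _).le)]
    congr 1
    have := integral_exp_mul_Ioi (a := -l) (by linarith) 0
    simp only [neg_mul, mul_zero, Real.exp_zero] at this
    rw [this]; field_simp
  · have hset : {t : ℝ | ENNReal.ofReal t ≤ s} = Iic s.toReal := by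
      ext t
      rw [mem_ofPred_eq, mem_Iic, ENNReal.ofReal_le_iff_le_toReal hs]
    have hfun : ∀ t : ℝ, ENNReal.ofReal (Real.exp (-(l * t))) * (Iic s.toReal).indicator 1 t =
        (Iic s.toReal).indicator (fun t => ENNReal.ofReal (Real.exp (-(l * t)))) t := by
      intro t
      by_cases ht : t ∈ Iic s.toReal <;> simp [ht]
    rw [hset]
    simp only [hfun]
    rw [setLIntegral_indicator measurableSet_Iic, inter_comm, Ioi_inter_Iic,
      ← ofReal_integral_eq_lintegral_ofReal
        (Continuous.integrableOn_Ioc (by fun_prop))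
        (ae_of_all _ fun t => (Real.exp_pos _).le),
      ← intervalIntegral.integral_of_le ENNReal.toReal_nonneg,
      intervalIntegral.integral_eq_sub_of_hasDerivAt (fun t _ => hderiv t)
        (Continuous.intervalIntegrable (by fun_prop) _ _), if_neg hs]
    congr 1
    simp only [mul_zero, neg_zero, Real.exp_zero]
    ring

/-- `∫₀^∞ e^{-lt} Pr(S_x ≥ t) dt = (1 - e^{-x l 𝒦(l)}) / l`, by Tonelli's theorem. -/
lemma IsSubordinatorOf.lintegral_exp_mul_prob [IsProbabilityMeasure Pr]
    (hS : IsSubordinatorOf Pr S k) (x : ℝ≥0) {l : ℝ} (hl : 0 < l) :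
    ∫⁻ t in Ioi (0 : ℝ), ENNReal.ofReal (Real.exp (-(l * t))) *
        Pr {ω | ENNReal.ofReal t ≤ S x ω} =
      ENNReal.ofReal ((1 - Real.exp (-(x * (l * laplace k l)))) / l) := by
  have hSm := hS.measurable x
  have hset : MeasurableSet {p : ℝ × Ω | ENNReal.ofReal p.1 ≤ S x p.2} :=
    measurableSet_le (ENNReal.measurable_ofReal.comp measurable_fst) (hSm.comp measurable_snd)
  have h1 : ∀ t : ℝ, ENNReal.ofReal (Real.exp (-(l * t))) * Pr {ω | ENNReal.ofReal t ≤ S x ω} =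
      ∫⁻ ω, ENNReal.ofReal (Real.exp (-(l * t))) *
        {t | ENNReal.ofReal t ≤ S x ω}.indicator 1 t ∂Pr := by
    intro t
    rw [lintegral_const_mul' _ _ ENNReal.ofReal_ne_top]
    congr 1
    rw [← lintegral_indicator_one (measurableSet_le measurable_const hSm)]
    rfl
  simp only [h1]
  rw [lintegral_lintegral_swap]
  · simp only [lintegral_exp_indicator hl]
    have hb : ∀ ω, (if S x ω = ∞ then 0 else Real.exp (-(l * (S x ω).toReal))) ≤ 1 := by
      intro ω
      split_ifs
      · exact zero_le_one
      · exact Real.exp_le_one_iff.2 (by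
          have := mul_nonneg hl.le (ENNReal.toReal_nonneg (a := S x ω)); linarith)
    have hb0 : ∀ ω, 0 ≤ (if S x ω = ∞ then 0 else Real.exp (-(l * (S x ω).toReal))) := by
      intro ω
      split_ifs
      · exact le_rfl
      · exact (Real.exp_pos _).le
    have hint : Integrable (fun ω => if S x ω = ∞ then 0
        else Real.exp (-(l * (S x ω).toReal))) Pr := by
      refine Integrable.of_bound (C := 1) (Measurable.aestronglyMeasurable ?_)
        (ae_of_all _ fun ω => by rw [Real.norm_of_nonneg (hb0 ω)]; exact hb ω)
      exact Measurable.ite (hSm (measurableSet_singleton _)) measurable_const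
        (by fun_prop)
    have hint' : Integrable (fun ω => (1 - if S x ω = ∞ then 0
        else Real.exp (-(l * (S x ω).toReal))) / l) Pr :=
      ((integrable_const 1).sub hint).div_const l
    rw [← ofReal_integral_eq_lintegral_ofReal hint'
      (ae_of_all _ fun ω => div_nonneg (sub_nonneg.2 (hb ω)) hl.le), integral_div,
      integral_sub (integrable_const 1) hint, hS.laplaceExponent x l hl]
    simp
  · refine Measurable.aemeasurable ?_
    refine Measurable.mul (by fun_prop) ?_
    exact (measurable_const (a := (1 : ℝ≥0∞))).indicator hset

/-- Averaged over an exponential time of rate `l`, the inverse process has the exponential law of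
rate `l 𝒦(l)`; the common factor `l` is left out here. -/
theorem IsInverseDensity.bind_inverseLaw [IsProbabilityMeasure Pr]
    (hG : IsInverseDensity Pr S G) (hS : IsSubordinatorOf Pr S k) {l : ℝ} (hl : 0 < l)
    (hK : 0 ≤ laplace k l) :
    ((volume.restrict (Ioi 0)).withDensity
        fun t => ENNReal.ofReal (Real.exp (-(l * t)))).bind (inverseLaw G) =
      (volume.restrict (Ioi 0)).withDensity
        fun τ => ENNReal.ofReal (laplace k l * Real.exp (-(l * laplace k l * τ))) := by
  have hm := hG.measurable_inverseLaw hS.toIsSubordinator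
  have hexp : Measurable fun t : ℝ => ENNReal.ofReal (Real.exp (-(l * t))) := by fun_prop
  have happ : ∀ B, MeasurableSet B → ((volume.restrict (Ioi 0)).withDensity
        fun t => ENNReal.ofReal (Real.exp (-(l * t)))).bind (inverseLaw G) B =
      ∫⁻ t in Ioi (0 : ℝ), ENNReal.ofReal (Real.exp (-(l * t))) * inverseLaw G t B := by
    intro B hB
    rw [Measure.bind_apply hB hm.aemeasurable,
      lintegral_withDensity_eq_lintegral_mul _ hexp
        (g := fun t => inverseLaw G t B) (Measure.measurable_coe hB |>.comp hm)]
    rfl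
  have hfin : IsFiniteMeasure (((volume.restrict (Ioi 0)).withDensity
        fun t => ENNReal.ofReal (Real.exp (-(l * t)))).bind (inverseLaw G)) := by
    constructor
    rw [happ _ .univ]
    refine lt_of_le_of_lt (b := ∫⁻ t in Ioi (0 : ℝ), ENNReal.ofReal (Real.exp (-(l * t))))
      (lintegral_mono fun t => ?_) ?_
    · exact mul_le_of_le_one_right' (hG.inverseLaw_univ_le hS.toIsSubordinator t)
    · have := lintegral_exp_indicator hl ∞
      simp only [le_top, ofPred_true, indicator_univ, Pi.one_apply, mul_one] at this
      rw [this]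
      exact ENNReal.ofReal_lt_top
  refine Measure.ext_of_Iic _ _ fun x => ?_
  rw [happ _ measurableSet_Iic, withDensity_apply _ measurableSet_Iic,
    Measure.restrict_restrict measurableSet_Iic, inter_comm, Ioi_inter_Iic]
  rcases le_total x 0 with hx | hx
  · simp only [inverseLaw_Iic_of_nonpos _ hx, Ioc_eq_empty (not_lt.2 hx)]
    simp
  · have h1 : ∫⁻ t in Ioi (0 : ℝ), ENNReal.ofReal (Real.exp (-(l * t))) * inverseLaw G t (Iic x)
        = ∫⁻ t in Ioi (0 : ℝ), ENNReal.ofReal (Real.exp (-(l * t))) *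
          Pr {ω | ENNReal.ofReal t ≤ S x.toNNReal ω} :=
      setLIntegral_congr_fun measurableSet_Ioi fun t ht => by
        simp only [hG.inverseLaw_Iic hS.toIsSubordinator (mem_Ioi.1 ht) hx]
    rw [h1, hS.lintegral_exp_mul_prob _ hl, Real.coe_toNNReal _ hx]
    have hderiv : ∀ t : ℝ, HasDerivAt (fun t => -(Real.exp (-(l * laplace k l * t)) / l))
        (laplace k l * Real.exp (-(l * laplace k l * t))) t := by
      intro t
      have h1 : HasDerivAt (fun t => -(l * laplace k l * t)) (-(l * laplace k l * 1)) t :=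
        ((hasDerivAt_id t).const_mul _).neg
      refine (h1.exp.div_const l).neg.congr_deriv ?_
      field_simp
    rw [← ofReal_integral_eq_lintegral_ofReal
        (Continuous.integrableOn_Ioc (by fun_prop))
        (ae_of_all _ fun t => mul_nonneg hK (Real.exp_pos _).le),
      ← intervalIntegral.integral_of_le hx,
      intervalIntegral.integral_eq_sub_of_hasDerivAt (fun t _ => hderiv t)
        (Continuous.intervalIntegrable (by fun_prop) _ _)]
    congr 1
    simp only [mul_zero, neg_zero, Real.exp_zero]
    ring_nf

end InverseSubordinator

section SubordinatedFunction

variable {Ω : Type*} [MeasurableSpace Ω] {Pr : Measure Ω}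
  {S : ℝ≥0 → Ω → ℝ≥0∞} {k : ℝ → ℝ} {G : ℝ → ℝ → ℝ}

lemma laplace_nonneg {g : ℝ → ℝ} (hg : ∀ t, 0 < t → 0 ≤ g t) (l : ℝ) : 0 ≤ laplace g l :=
  setIntegral_nonneg measurableSet_Ioi fun t ht => mul_nonneg (Real.exp_pos _).le (hg t ht)

lemma IsInverseDensity.lintegral_exp_mul_lintegral [IsProbabilityMeasure Pr]
    (hG : IsInverseDensity Pr S G)
    (hS : IsSubordinatorOf Pr S k) {l : ℝ} (hl : 0 < l) (hK : 0 ≤ laplace k l)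
    {f : ℝ → ℝ≥0∞} (hf : Measurable f) :
    ∫⁻ t in Ioi (0 : ℝ), ENNReal.ofReal (Real.exp (-(l * t))) * ∫⁻ τ, f τ ∂inverseLaw G t =
      ∫⁻ τ in Ioi (0 : ℝ),
        ENNReal.ofReal (laplace k l * Real.exp (-(l * laplace k l * τ))) * f τ := by
  have hm := hG.measurable_inverseLaw hS.toIsSubordinator
  have h := congrArg (fun μ => ∫⁻ τ, f τ ∂μ) (hG.bind_inverseLaw hS hl hK)
  rw [Measure.lintegral_bind hm.aemeasurable hf.aemeasurable,
    lintegral_withDensity_eq_lintegral_mul _ (by fun_prop)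
      (g := fun t => ∫⁻ τ, f τ ∂inverseLaw G t) ((Measure.measurable_lintegral hf).comp hm),
    lintegral_withDensity_eq_lintegral_mul _ (by fun_prop) hf] at h
  exact h

lemma IsInverseDensity.lintegral_inverseLaw (hG : IsInverseDensity Pr S G) {f : ℝ → ℝ}
    (hf : Measurable f) {t : ℝ} (ht : 0 < t) :
    ∫⁻ τ, ENNReal.ofReal (f τ) ∂inverseLaw G t =
      ∫⁻ τ in Ioi (0 : ℝ), ENNReal.ofReal (f τ * G t τ) := by
  have hGt := hG.measurable t ht
  rw [inverseLaw, if_pos ht,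
    lintegral_withDensity_eq_lintegral_mul _ (by fun_prop) (by fun_prop)]
  refine setLIntegral_congr_fun measurableSet_Ioi fun τ hτ => ?_
  simp only [Pi.mul_apply]
  rw [mul_comm (f τ), ENNReal.ofReal_mul (hG.nonneg t ht τ hτ)]

lemma IsInverseDensity.subordination_eq (hG : IsInverseDensity Pr S G) {f : ℝ → ℝ}
    (hf : Measurable f) (hf0 : ∀ t, 0 < t → 0 ≤ f t) {t : ℝ} (ht : 0 < t) :
    subordination f G t = (∫⁻ τ, ENNReal.ofReal (f τ) ∂inverseLaw G t).toReal := by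
  have hGt := hG.measurable t ht
  rw [hG.lintegral_inverseLaw hf ht, subordination, integral_eq_lintegral_of_nonneg_ae]
  · filter_upwards [ae_restrict_mem measurableSet_Ioi] with τ hτ
    exact mul_nonneg (hf0 τ hτ) (hG.nonneg t ht τ hτ)
  · exact (hf.mul hGt).aestronglyMeasurable

lemma IsInverseDensity.subordination_nonneg (hG : IsInverseDensity Pr S G) {f : ℝ → ℝ}
    (hf0 : ∀ t, 0 < t → 0 ≤ f t) {t : ℝ} (ht : 0 < t) : 0 ≤ subordination f G t :=
  setIntegral_nonneg measurableSet_Ioi fun τ hτ =>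
    mul_nonneg (hf0 τ hτ) (hG.nonneg t ht τ hτ)

lemma IsInverseDensity.lintegral_exp_mul_subordination [IsProbabilityMeasure Pr]
    (hG : IsInverseDensity Pr S G)
    (hS : IsSubordinatorOf Pr S k) {f : ℝ → ℝ}
    (hf : Measurable f) (hf0 : ∀ t, 0 < t → 0 ≤ f t) {l : ℝ} (hl : 0 < l)
    (hK : 0 ≤ laplace k l)
    (hint : IntegrableOn (fun τ => Real.exp (-(l * laplace k l * τ)) * f τ) (Ioi 0)) :
    ∫⁻ t in Ioi (0 : ℝ), ENNReal.ofReal (Real.exp (-(l * t))) *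
        ∫⁻ τ, ENNReal.ofReal (f τ) ∂inverseLaw G t =
      ENNReal.ofReal (laplace k l * laplace f (l * laplace k l)) := by
  rw [hG.lintegral_exp_mul_lintegral hS hl hK (by fun_prop), laplace.eq_1 f,
    ← integral_const_mul, ofReal_integral_eq_lintegral_ofReal (hint.const_mul _)]
  · refine lintegral_congr fun τ => ?_
    rw [← ENNReal.ofReal_mul (mul_nonneg hK (Real.exp_pos _).le), mul_assoc]
  · filter_upwards [ae_restrict_mem measurableSet_Ioi] with τ hτ
    exact mul_nonneg hK (mul_nonneg (Real.exp_pos _).le (hf0 τ hτ))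

lemma IsInverseDensity.integrableOn_exp_mul_subordination [IsProbabilityMeasure Pr]
    (hG : IsInverseDensity Pr S G)
    (hS : IsSubordinatorOf Pr S k) {f : ℝ → ℝ}
    (hf : Measurable f) (hf0 : ∀ t, 0 < t → 0 ≤ f t) {l : ℝ} (hl : 0 < l)
    (hK : 0 ≤ laplace k l)
    (hint : IntegrableOn (fun τ => Real.exp (-(l * laplace k l * τ)) * f τ) (Ioi 0)) :
    IntegrableOn (fun t => Real.exp (-(l * t)) * subordination f G t) (Ioi 0) := by
  have hm := hG.measurable_inverseLaw hS.toIsSubordinator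
  have hV : Measurable fun t => ∫⁻ τ, ENNReal.ofReal (f τ) ∂inverseLaw G t :=
    (Measure.measurable_lintegral (by fun_prop)).comp hm
  have h := integrable_toReal_of_lintegral_ne_top (μ := volume.restrict (Ioi (0 : ℝ)))
    (f := fun t => ENNReal.ofReal (Real.exp (-(l * t))) *
      ∫⁻ τ, ENNReal.ofReal (f τ) ∂inverseLaw G t) (Measurable.aemeasurable (by fun_prop))
    (by rw [hG.lintegral_exp_mul_subordination hS hf hf0 hl hK hint]; exact ENNReal.ofReal_ne_top)
  refine Integrable.congr h ?_
  filter_upwards [ae_restrict_mem measurableSet_Ioi] with t ht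
  rw [ENNReal.toReal_mul, ENNReal.toReal_ofReal (Real.exp_pos _).le,
    hG.subordination_eq hf hf0 ht]

/-- The Laplace transform of the subordinated function: `𝓛[f^E](l) = 𝒦(l) 𝓛[f](l 𝒦(l))`. -/
theorem IsInverseDensity.laplace_subordination [IsProbabilityMeasure Pr]
    (hG : IsInverseDensity Pr S G)
    (hS : IsSubordinatorOf Pr S k) {f : ℝ → ℝ}
    (hf : Measurable f) (hf0 : ∀ t, 0 < t → 0 ≤ f t) {l : ℝ} (hl : 0 < l)
    (hK : 0 ≤ laplace k l)
    (hint : IntegrableOn (fun τ => Real.exp (-(l * laplace k l * τ)) * f τ) (Ioi 0)) :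
    laplace (subordination f G) l = laplace k l * laplace f (l * laplace k l) := by
  have hi := hG.integrableOn_exp_mul_subordination hS hf hf0 hl hK hint
  have hfin : ∀ᵐ t ∂volume.restrict (Ioi (0 : ℝ)), ENNReal.ofReal (Real.exp (-(l * t))) *
      ∫⁻ τ, ENNReal.ofReal (f τ) ∂inverseLaw G t < ∞ := by
    have hV : Measurable fun t => ∫⁻ τ, ENNReal.ofReal (f τ) ∂inverseLaw G t :=
      (Measure.measurable_lintegral (by fun_prop)).comp
        (hG.measurable_inverseLaw hS.toIsSubordinator)
    refine ae_lt_top (by fun_prop) ?_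
    rw [hG.lintegral_exp_mul_subordination hS hf hf0 hl hK hint]
    exact ENNReal.ofReal_ne_top
  have h0 : 0 ≤ laplace k l * laplace f (l * laplace k l) :=
    mul_nonneg hK (laplace_nonneg hf0 _)
  rw [← ENNReal.toReal_ofReal h0, ← hG.lintegral_exp_mul_subordination hS hf hf0 hl hK hint,
    laplace, integral_eq_lintegral_of_nonneg_ae _ hi.aestronglyMeasurable]
  · congr 1
    refine lintegral_congr_ae ?_
    filter_upwards [hfin, ae_restrict_mem measurableSet_Ioi] with t hfin ht
    have hne : ∫⁻ τ, ENNReal.ofReal (f τ) ∂inverseLaw G t ≠ ∞ := fun h => by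
      rw [h, ENNReal.mul_top (by simp [Real.exp_pos])] at hfin
      exact lt_irrefl _ hfin
    rw [ENNReal.ofReal_mul (Real.exp_pos _).le, hG.subordination_eq hf hf0 ht,
      ENNReal.ofReal_toReal hne]
  · filter_upwards [ae_restrict_mem measurableSet_Ioi] with t ht
    exact mul_nonneg (Real.exp_pos _).le (hG.subordination_nonneg hf0 ht)

lemma IsInverseDensity.subordinationConverges [IsProbabilityMeasure Pr]
    (hG : IsInverseDensity Pr S G)
    (hS : IsSubordinatorOf Pr S k) {f : ℝ → ℝ}
    (hf : Measurable f) (hf0 : ∀ t, 0 < t → 0 ≤ f t) (hK : 0 ≤ laplace k 1)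
    (hint : IntegrableOn (fun τ => Real.exp (-(1 * laplace k 1 * τ)) * f τ) (Ioi 0)) :
    SubordinationConverges f G := by
  refine ⟨?_, fun t _ => integrableOn_Ioc_of_laplace
    (hG.integrableOn_exp_mul_subordination hS hf hf0 one_pos hK hint) t⟩
  have hV : Measurable fun t => ∫⁻ τ, ENNReal.ofReal (f τ) ∂inverseLaw G t :=
    (Measure.measurable_lintegral (by fun_prop)).comp
      (hG.measurable_inverseLaw hS.toIsSubordinator)
  have hfin : ∀ᵐ t ∂volume.restrict (Ioi (0 : ℝ)), ENNReal.ofReal (Real.exp (-(1 * t))) *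
      ∫⁻ τ, ENNReal.ofReal (f τ) ∂inverseLaw G t < ∞ := by
    refine ae_lt_top (by fun_prop) ?_
    rw [hG.lintegral_exp_mul_subordination hS hf hf0 one_pos hK hint]
    exact ENNReal.ofReal_ne_top
  filter_upwards [hfin, ae_restrict_mem measurableSet_Ioi] with t hfin ht
  have hGt := hG.measurable t ht
  refine ⟨(hf.mul hGt).aestronglyMeasurable, ?_⟩
  rw [hasFiniteIntegral_iff_ofReal, ← hG.lintegral_inverseLaw hf ht]
  · refine lt_top_iff_ne_top.2 fun h => ?_
    rw [h, ENNReal.mul_top (by simp [Real.exp_pos])] at hfin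
    exact lt_irrefl _ hfin
  · filter_upwards [ae_restrict_mem measurableSet_Ioi] with τ hτ
    exact mul_nonneg (hf0 τ hτ) (hG.nonneg t ht τ hτ)

/-! ### Long-time behaviour of the Cesàro mean -/

lemma integrableOn_exp_mul_of_le {f : ℝ → ℝ} {p q : ℝ} (hpq : p ≤ q)
    (hf : IntegrableOn (fun t => Real.exp (-(p * t)) * f t) (Ioi 0)) :
    IntegrableOn (fun t => Real.exp (-(q * t)) * f t) (Ioi 0) := by
  have h1 : IntegrableOn (fun t => Real.exp (-((q - p) * t)) * (Real.exp (-(p * t)) * f t))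
      (Ioi 0) := by
    refine Integrable.bdd_mul (c := 1) hf (Continuous.aestronglyMeasurable (by fun_prop)) ?_
    filter_upwards [ae_restrict_mem measurableSet_Ioi] with t ht
    rw [Real.norm_eq_abs, Real.abs_exp, Real.exp_le_one_iff, neg_nonpos]
    exact mul_nonneg (sub_nonneg.2 hpq) (mem_Ioi.1 ht).le
  refine h1.congr (ae_of_all _ fun t => ?_)
  simp only [← mul_assoc, ← Real.exp_add]
  congr 2
  ring

/-- If `∫_0^{1/l} g ~ c w(l)` as `l → 0+`, then the Cesàro mean of `g` is equivalent to
`c w(1/t) / t`. For `c = 0` the vanishing of `g` has to be assumed. -/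
lemma cesaroMean_isEquivalent {g w u : ℝ → ℝ} {c : ℝ}
    (hw : ∀ᶠ l in 𝓝[>] 0, 0 < w l)
    (h : Tendsto (fun l => (∫ t in Ioc 0 l⁻¹, g t) / w l) (𝓝[>] 0) (𝓝 c))
    (hc : c = 0 → ∀ t, 0 < t → g t = 0)
    (hu : ∀ᶠ t in atTop, u t = c * (w t⁻¹ / t)) :
    cesaroMean g ~[atTop] u := by
  have hces : ∀ t, 0 < t → cesaroMean g t = (∫ s in Ioc 0 t, g s) / t := fun t ht => by
    rw [cesaroMean, intervalIntegral.integral_of_le ht.le]; ring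
  have hinv := tendsto_inv_atTop_nhdsGT_zero (𝕜 := ℝ)
  by_cases hc0 : c = 0
  · have h1 : cesaroMean g =ᶠ[atTop] u := by
      filter_upwards [hu, eventually_gt_atTop 0] with t hut ht
      rw [hut, hc0, zero_mul, hces t ht,
        setIntegral_eq_zero_of_forall_eq_zero fun s hs => hc hc0 s hs.1, zero_div]
    exact h1.isEquivalent
  · refine isEquivalent_of_tendsto_one ?_
    have h2 := (h.comp hinv).div_const c
    rw [div_self hc0] at h2
    refine h2.congr' ?_
    filter_upwards [hu, eventually_gt_atTop 0, hinv.eventually hw] with t hut ht hwt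
    simp only [Function.comp, inv_inv, Pi.div_apply]
    rw [hut, hces t ht]
    field_simp

lemma subordination_eq_zero_of_laplace {f : ℝ → ℝ} {p : ℝ} (hf0 : ∀ t, 0 < t → 0 ≤ f t)
    (hf : IntegrableOn (fun t => Real.exp (-(p * t)) * f t) (Ioi 0)) (h : laplace f p = 0)
    (t : ℝ) : subordination f G t = 0 := by
  have h0 := (integral_eq_zero_iff_of_nonneg_ae (by
    filter_upwards [ae_restrict_mem measurableSet_Ioi] with t ht
    exact mul_nonneg (Real.exp_pos _).le (hf0 t ht)) hf).1 h
  refine integral_eq_zero_of_ae ?_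
  filter_upwards [h0] with τ hτ
  have : f τ = 0 := by simpa [Real.exp_ne_zero] using hτ
  simp [this]

/-- The long-time behaviour of the Cesàro mean of `f^E` when `𝒦(l) ~ C w(l)` as `l → 0+`, with `w`
regularly varying at `0` of index `-ρ < 0`, and `l 𝒦(l)` decreases to `p` as `l → 0+`. -/
theorem cesaroMean_subordination_of_regularVariation [IsProbabilityMeasure Pr]
    (hG : IsInverseDensity Pr S G)
    (hS : IsSubordinatorOf Pr S k) (hk : IsKernel k) {f : ℝ → ℝ} (hf : Measurable f)
    (hf0 : ∀ t, 0 < t → 0 ≤ f t) {p ρ C : ℝ} {w u : ℝ → ℝ} (hρ : 0 < ρ) (hC : 0 < C)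
    (hfp : IntegrableOn (fun t => Real.exp (-(p * t)) * f t) (Ioi 0))
    (hp : ∀ l, 0 < l → p ≤ l * laplace k l)
    (hlim : Tendsto (fun l => l * laplace k l) (𝓝[>] 0) (𝓝 p))
    (hw : ∀ᶠ l in 𝓝[>] 0, 0 < w l)
    (hkw : Tendsto (fun l => laplace k l / w l) (𝓝[>] 0) (𝓝 C))
    (hreg : ∀ n : ℕ, Tendsto (fun l => w ((n + 1) * l) / w l) (𝓝[>] 0)
      (𝓝 (((n : ℝ) + 1) ^ (-ρ))))
    (hu : ∀ᶠ t in atTop, u t = C * laplace f p / Real.Gamma (ρ + 1) * (w t⁻¹ / t)) :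
    SubordinationConverges f G ∧ cesaroMean (subordination f G) ~[atTop] u := by
  have hK := fun l => laplace_nonneg hk.nonneg l
  have hint := fun l (hl : 0 < l) => integrableOn_exp_mul_of_le (hp l hl) hfp
  refine ⟨hG.subordinationConverges hS hf hf0 (hK 1) (hint 1 one_pos), ?_⟩
  have hpos : ∀ᶠ l : ℝ in 𝓝[>] 0, 0 < l := eventually_mem_nhdsWithin
  have hF : Tendsto (fun l => laplace f (l * laplace k l)) (𝓝[>] 0) (𝓝 (laplace f p)) :=
    tendsto_laplace hfp hlim (hpos.mono hp)
  refine cesaroMean_isEquivalent hw (tendsto_integral_of_tendsto_laplace (c := C * laplace f p)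
    hρ (fun t ht => hG.subordination_nonneg hf0 ht)
    (fun l hl => hG.integrableOn_exp_mul_subordination hS hf hf0 hl (hK l) (hint l hl)) hw
    fun n => ?_) (fun hc t _ => subordination_eq_zero_of_laplace hf0 hfp ?_ t) hu
  · have hmul : Tendsto (fun l : ℝ => ((n : ℝ) + 1) * l) (𝓝[>] 0) (𝓝[>] 0) := by
      refine tendsto_nhdsWithin_iff.2 ⟨?_, hpos.mono fun l hl => ?_⟩
      · have : Tendsto (fun l : ℝ => ((n : ℝ) + 1) * l) (𝓝 0) (𝓝 (((n : ℝ) + 1) * 0)) :=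
          tendsto_id.const_mul _
        rw [mul_zero] at this
        exact this.mono_left nhdsWithin_le_nhds
      · exact mul_pos (by positivity) hl
    have h := ((hkw.comp hmul).mul (hF.comp hmul)).mul (hreg n)
    refine h.congr' ?_
    filter_upwards [hpos, hw, hmul.eventually hw] with l hl hwl hwl'
    have hl' : 0 < ((n : ℝ) + 1) * l := mul_pos (by positivity) hl
    rw [hG.laplace_subordination hS hf hf0 hl' (hK _) (hint _ hl')]
    simp only [Function.comp]
    field_simp
  · have hΓ := Real.Gamma_pos_of_pos (show 0 < ρ + 1 by linarith)
    rcases div_eq_zero_iff.1 hc with h | h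
    · exact (mul_eq_zero.1 h).resolve_left hC.ne'
    · exact absurd h hΓ.ne'

/-- The long-time behaviour of the Cesàro mean of `f^E` when `𝒦` has a finite positive limit
at `0`. -/
theorem cesaroMean_subordination_of_tendsto [IsProbabilityMeasure Pr]
    (hG : IsInverseDensity Pr S G)
    (hS : IsSubordinatorOf Pr S k) (hk : IsKernel k) {f : ℝ → ℝ} (hf : Measurable f)
    (hf0 : ∀ t, 0 < t → 0 ≤ f t) {C : ℝ} {u : ℝ → ℝ} (hC : 0 < C)
    (hfi : IntegrableOn f (Ioi 0))
    (hkC : Tendsto (laplace k) (𝓝[>] 0) (𝓝 C))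
    (hu : ∀ t, u t = C * laplace f 0 * t⁻¹) :
    SubordinationConverges f G ∧ cesaroMean (subordination f G) ~[atTop] u := by
  have hK := fun l => laplace_nonneg hk.nonneg l
  have hpos : ∀ᶠ l : ℝ in 𝓝[>] 0, 0 < l := eventually_mem_nhdsWithin
  have hfp : IntegrableOn (fun t => Real.exp (-(0 * t)) * f t) (Ioi 0) := by simpa using hfi
  have hp : ∀ l, 0 < l → 0 ≤ l * laplace k l := fun l hl => mul_nonneg hl.le (hK l)
  have hint := fun l (hl : 0 < l) => integrableOn_exp_mul_of_le (hp l hl) hfp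
  refine ⟨hG.subordinationConverges hS hf hf0 (hK 1) (hint 1 one_pos), ?_⟩
  have hid : Tendsto (fun l : ℝ => l) (𝓝[>] 0) (𝓝 0) := tendsto_id.mono_left nhdsWithin_le_nhds
  have hlim : Tendsto (fun l => l * laplace k l) (𝓝[>] 0) (𝓝 0) := by
    simpa using hid.mul hkC
  have hF : Tendsto (fun l => laplace f (l * laplace k l)) (𝓝[>] 0) (𝓝 (laplace f 0)) :=
    tendsto_laplace hfp hlim (hpos.mono hp)
  have htaub := tendsto_integral_of_tendsto_laplace_zero (c := C * laplace f 0)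
    (fun t ht => hG.subordination_nonneg (G := G) hf0 ht)
    (fun l hl => hG.integrableOn_exp_mul_subordination hS hf hf0 hl (hK l) (hint l hl)) (by
      refine (hkC.mul hF).congr' ?_
      filter_upwards [hpos] with l hl
      rw [hG.laplace_subordination hS hf hf0 hl (hK _) (hint _ hl)])
  refine cesaroMean_isEquivalent (w := fun _ => 1) (Eventually.of_forall fun _ => one_pos)
    (by simpa only [div_one] using htaub)
    (fun hc t _ => subordination_eq_zero_of_laplace hf0 hfp
      ((mul_eq_zero.1 hc).resolve_left hC.ne') t)
    (Eventually.of_forall fun t => by rw [hu, one_div])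

end SubordinatedFunction

/-! ### The classes of kernels -/

section KernelClasses

variable {Ω : Type*} [MeasurableSpace Ω] {Pr : Measure Ω} [IsProbabilityMeasure Pr]
  {S : ℝ≥0 → Ω → ℝ≥0∞} {k : ℝ → ℝ} {G : ℝ → ℝ → ℝ} {f : ℝ → ℝ}

/-- The regularly varying case with a pure power. -/
theorem cesaroMean_subordination_of_rpow (hG : IsInverseDensity Pr S G)
    (hS : IsSubordinatorOf Pr S k) (hk : IsKernel k) (hf : Measurable f)
    (hf0 : ∀ t, 0 < t → 0 ≤ f t) {p ρ C : ℝ} {u : ℝ → ℝ} (hρ : 0 < ρ) (hC : 0 < C)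
    (hfp : IntegrableOn (fun t => Real.exp (-(p * t)) * f t) (Ioi 0))
    (hp : ∀ l, 0 < l → p ≤ l * laplace k l)
    (hlim : Tendsto (fun l => l * laplace k l) (𝓝[>] 0) (𝓝 p))
    (hkw : Tendsto (fun l => l ^ ρ * laplace k l) (𝓝[>] 0) (𝓝 C))
    (hu : ∀ t, 0 < t → u t = C * laplace f p / Real.Gamma (ρ + 1) * t ^ (ρ - 1)) :
    SubordinationConverges f G ∧ cesaroMean (subordination f G) ~[atTop] u := by
  have hpos : ∀ᶠ l : ℝ in 𝓝[>] 0, 0 < l := eventually_mem_nhdsWithin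
  refine cesaroMean_subordination_of_regularVariation hG hS hk hf hf0 (w := fun l => l ^ (-ρ))
    hρ hC hfp hp hlim (hpos.mono fun l hl => Real.rpow_pos_of_pos hl _) (hkw.congr' ?_)
    (fun n => ?_) ?_
  · filter_upwards [hpos] with l hl
    rw [Real.rpow_neg hl.le, div_inv_eq_mul, mul_comm]
  · refine tendsto_const_nhds.congr' ?_
    filter_upwards [hpos] with l hl
    rw [Real.mul_rpow (by positivity) hl.le,
      mul_div_cancel_right₀ _ (Real.rpow_pos_of_pos hl _).ne']
  · filter_upwards [eventually_gt_atTop 0] with t ht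
    rw [hu t ht, Real.inv_rpow ht.le, Real.rpow_neg ht.le, inv_inv, Real.rpow_sub_one ht.ne']

theorem cesaroMean_subordination_of_stableClass (hG : IsInverseDensity Pr S G)
    (hS : IsSubordinatorOf Pr S k) (hk : IsKernel k) (hf : Measurable f)
    (hf0 : ∀ t, 0 < t → 0 ≤ f t) (hfi : IntegrableOn f (Ioi 0))
    {θ : ℝ} (hθ0 : 0 < θ) (hθ1 : θ < 1) (h : StableClass θ k) :
    SubordinationConverges f G ∧ cesaroMean (subordination f G) ~[atTop]
      fun t => laplace f 0 / Real.Gamma (2 - θ) * t ^ (-θ) := by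
  have hpos : ∀ᶠ l : ℝ in 𝓝[>] 0, 0 < l := eventually_mem_nhdsWithin
  refine cesaroMean_subordination_of_rpow hG hS hk hf hf0 (p := 0) (ρ := 1 - θ) (C := 1)
    (by linarith) one_pos (by simpa using hfi)
    (fun l hl => mul_nonneg hl.le (laplace_nonneg hk.nonneg l)) ?_ ?_ fun t _ => ?_
  · have h0 : Tendsto (fun l : ℝ => l ^ θ) (𝓝[>] 0) (𝓝 0) := by
      have := (Real.continuousAt_rpow_const 0 θ (Or.inr hθ0.le)).tendsto
      rw [Real.zero_rpow hθ0.ne'] at this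
      exact this.mono_left nhdsWithin_le_nhds
    refine h0.congr' ?_
    filter_upwards [hpos] with l hl
    rw [h l hl, Real.rpow_sub_one hl.ne']
    field_simp
  · refine tendsto_const_nhds.congr' ?_
    filter_upwards [hpos] with l hl
    rw [h l hl, ← Real.rpow_add hl]
    simp
  · rw [one_mul, show 1 - θ + 1 = 2 - θ by ring, show 1 - θ - 1 = -θ by ring]

theorem cesaroMean_subordination_of_distributedOrderClass (hG : IsInverseDensity Pr S G)
    (hS : IsSubordinatorOf Pr S k) (hk : IsKernel k) (hf : Measurable f)
    (hf0 : ∀ t, 0 < t → 0 ≤ f t) (hfi : IntegrableOn f (Ioi 0))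
    {C κ : ℝ} (hC : 0 < C) (hκ : 0 < κ) (h : DistributedOrderClass C κ k) :
    SubordinationConverges f G ∧ cesaroMean (subordination f G) ~[atTop]
      fun t => C * laplace f 0 * (Real.log t) ^ (-κ) := by
  have hpos : ∀ᶠ l : ℝ in 𝓝[>] 0, 0 < l := eventually_mem_nhdsWithin
  have hlog : Tendsto (fun l => -Real.log l) (𝓝[>] 0) atTop :=
    tendsto_neg_atBot_atTop.comp Real.tendsto_log_nhdsGT_zero
  have hlog0 : ∀ᶠ l : ℝ in 𝓝[>] 0, 0 < -Real.log l := hlog.eventually_gt_atTop 0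
  have hw : ∀ᶠ l : ℝ in 𝓝[>] 0, 0 < l⁻¹ * (-Real.log l) ^ (-κ) := by
    filter_upwards [hpos, hlog0] with l hl hl0
    exact mul_pos (inv_pos.2 hl) (Real.rpow_pos_of_pos hl0 _)
  have hkw : Tendsto (fun l => laplace k l / (l⁻¹ * (-Real.log l) ^ (-κ))) (𝓝[>] 0) (𝓝 C) := by
    have h1 := (isEquivalent_iff_tendsto_one (by
      filter_upwards [hw] with l hl
      rw [mul_assoc]
      exact (mul_pos hC hl).ne')).1 h
    have h2 := h1.const_mul C
    rw [mul_one] at h2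
    refine h2.congr' ?_
    filter_upwards [hw] with l hl
    rw [Pi.div_apply, mul_assoc C]
    field_simp
  refine cesaroMean_subordination_of_regularVariation hG hS hk hf hf0 (p := 0) (ρ := 1) (C := C)
    (w := fun l => l⁻¹ * (-Real.log l) ^ (-κ)) one_pos hC (by simpa using hfi)
    (fun l hl => mul_nonneg hl.le (laplace_nonneg hk.nonneg l)) ?_ hw hkw (fun n => ?_) ?_
  · have h1 := hkw.mul ((tendsto_rpow_neg_atTop hκ).comp hlog)
    rw [mul_zero] at h1
    refine h1.congr' ?_
    filter_upwards [hpos, hlog0] with l hl hl0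
    have := Real.rpow_pos_of_pos hl0 (-κ)
    simp only [Function.comp]
    field_simp
  · -- `log ((n + 1) l) / log l → 1`, so the logarithmic factor does not contribute to the index
    have h1 : Tendsto (fun l => 1 - Real.log (n + 1) / (-Real.log l)) (𝓝[>] 0) (𝓝 1) := by
      simpa using (tendsto_const_nhds (x := (1 : ℝ))).sub (hlog.const_div_atTop (Real.log (n + 1)))
    have h2 := ((Real.continuousAt_rpow_const 1 (-κ) (Or.inl one_ne_zero)).tendsto.comp
      h1).const_mul (((n : ℝ) + 1) ^ (-1 : ℝ))
    rw [Real.one_rpow, mul_one] at h2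
    refine h2.congr' ?_
    have h3 : ∀ᶠ l : ℝ in 𝓝[>] 0, 0 < 1 - Real.log (n + 1) / (-Real.log l) :=
      h1.eventually_const_lt zero_lt_one
    filter_upwards [hpos, hlog0, h3] with l hl hl0 hl3
    have hn : (0 : ℝ) < n + 1 := by positivity
    have he : -Real.log ((n + 1) * l) =
        (1 - Real.log (n + 1) / (-Real.log l)) * (-Real.log l) := by
      rw [Real.log_mul hn.ne' hl.ne', sub_mul, div_mul_cancel₀ _ hl0.ne']; ring
    have := Real.rpow_pos_of_pos hl0 (-κ)
    rw [he, Real.mul_rpow hl3.le hl0.le, Real.rpow_neg_one]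
    simp only [Function.comp]
    field_simp
  · filter_upwards [eventually_gt_atTop 0] with t ht
    rw [Real.log_inv, neg_neg, inv_inv, show (1 : ℝ) + 1 = 2 by norm_num, Real.Gamma_two]
    field_simp

/-- Here `l 𝒦(l) → √(ab) > 0`, the killing rate of the subordinator, so the transform of `f` is
evaluated at `√(ab)` in the limit, and `𝒦` varies regularly of index `-1`. -/
theorem cesaroMean_subordination_of_inverseGammaClass (hG : IsInverseDensity Pr S G)
    (hS : IsSubordinatorOf Pr S k) (hk : IsKernel k) (hf : Measurable f)
    (hf0 : ∀ t, 0 < t → 0 ≤ f t) {a b : ℝ} (ha : 0 < a) (hb : 0 < b)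
    (hfi : IntegrableOn (fun t => Real.exp (-(√(a * b) * t)) * f t) (Ioi 0))
    (h : InverseGammaClass a b k) :
    SubordinationConverges f G ∧ cesaroMean (subordination f G) ~[atTop]
      fun _ => √(a * b) * laplace f √(a * b) := by
  have hpos : ∀ᶠ l : ℝ in 𝓝[>] 0, 0 < l := eventually_mem_nhdsWithin
  have hval : ∀ l, 0 < l → l * laplace k l = √b * (2 * √(2 * l + a) - √a) := fun l hl => by
    rw [h l hl]; field_simp
  have hsq : √(a * b) = √b * (2 * √(2 * 0 + a) - √a) := by
    rw [mul_comm a, Real.sqrt_mul hb.le, mul_zero, zero_add]; ring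
  have hlim : Tendsto (fun l => l * laplace k l) (𝓝[>] 0) (𝓝 √(a * b)) := by
    rw [hsq]
    have hc : Continuous fun l : ℝ => √b * (2 * √(2 * l + a) - √a) := by fun_prop
    refine ((hc.tendsto 0).mono_left nhdsWithin_le_nhds).congr' ?_
    filter_upwards [hpos] with l hl
    rw [hval l hl]
  refine cesaroMean_subordination_of_rpow hG hS hk hf hf0 (p := √(a * b)) (ρ := 1)
    one_pos (Real.sqrt_pos.2 (mul_pos ha hb)) hfi (fun l hl => ?_) hlim
    (by simpa only [Real.rpow_one] using hlim) fun t _ => ?_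
  · rw [hval l hl, hsq]
    have := Real.sqrt_le_sqrt (show 2 * 0 + a ≤ 2 * l + a by linarith)
    gcongr
  · rw [show (1 : ℝ) + 1 = 2 by norm_num, Real.Gamma_two]
    simp

theorem cesaroMean_subordination_of_inverseGammaClass_zero (hG : IsInverseDensity Pr S G)
    (hS : IsSubordinatorOf Pr S k) (hk : IsKernel k) (hf : Measurable f)
    (hf0 : ∀ t, 0 < t → 0 ≤ f t) (hfi : IntegrableOn f (Ioi 0)) {b : ℝ} (hb : 0 < b)
    (h : InverseGammaClass 0 b k) :
    SubordinationConverges f G ∧ cesaroMean (subordination f G) ~[atTop]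
      fun t => 2 * √(2 * b) * laplace f 0 / Real.Gamma (3 / 2) * t ^ (-(1 / 2) : ℝ) := by
  have hpos : ∀ᶠ l : ℝ in 𝓝[>] 0, 0 < l := eventually_mem_nhdsWithin
  have hval : ∀ l, 0 < l → l * laplace k l = 2 * √(2 * b) * √l := fun l hl => by
    rw [h l hl, Real.sqrt_zero, sub_zero, add_zero, Real.sqrt_mul zero_le_two,
      Real.sqrt_mul zero_le_two]
    field_simp
  refine cesaroMean_subordination_of_rpow hG hS hk hf hf0 (p := 0) (ρ := 1 / 2)
    (C := 2 * √(2 * b)) (by norm_num) (by positivity) (by simpa using hfi)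
    (fun l hl => mul_nonneg hl.le (laplace_nonneg hk.nonneg l)) ?_ ?_ fun t _ => ?_
  · have hc : Continuous fun l : ℝ => 2 * √(2 * b) * √l := by fun_prop
    have h0 := (hc.tendsto 0).mono_left (nhdsWithin_le_nhds (s := Ioi 0))
    rw [Real.sqrt_zero, mul_zero] at h0
    refine h0.congr' ?_
    filter_upwards [hpos] with l hl
    rw [hval l hl]
  · refine tendsto_const_nhds.congr' ?_
    filter_upwards [hpos] with l hl
    have hs := Real.sqrt_pos.2 hl
    rw [← Real.sqrt_eq_rpow]
    refine mul_right_cancel₀ hs.ne' ?_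
    rw [← hval l hl, mul_right_comm, Real.mul_self_sqrt hl.le]
  · rw [show (1 : ℝ) / 2 + 1 = 3 / 2 by norm_num, show (1 : ℝ) / 2 - 1 = -(1 / 2) by norm_num]

theorem cesaroMean_subordination_of_gammaClass (hG : IsInverseDensity Pr S G)
    (hS : IsSubordinatorOf Pr S k) (hk : IsKernel k) (hf : Measurable f)
    (hf0 : ∀ t, 0 < t → 0 ≤ f t) (hfi : IntegrableOn f (Ioi 0)) {a b : ℝ} (ha : 0 < a)
    (hb : 0 < b) (h : GammaClass a b k) :
    SubordinationConverges f G ∧ cesaroMean (subordination f G) ~[atTop]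
      fun t => a * laplace f 0 / b * t⁻¹ := by
  refine cesaroMean_subordination_of_tendsto hG hS hk hf hf0 (C := a * (1 / b)) (by positivity)
    hfi ?_ fun t => by ring
  -- the limit is `a` times the derivative of `l ↦ log (1 + l / b)` at `0`
  have hd : HasDerivAt (fun l : ℝ => Real.log (1 + l / b)) (1 / b / (1 + 0 / b)) 0 :=
    (((hasDerivAt_id (0 : ℝ)).div_const b).const_add 1).log (by simp)
  have hs := hd.tendsto_slope_zero_right.const_mul a
  simp only [zero_div, add_zero, div_one, Real.log_one, sub_zero, zero_add, smul_eq_mul] at hs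
  refine hs.congr' ?_
  filter_upwards [self_mem_nhdsWithin] with l hl
  rw [h l hl]
  ring

theorem cesaroMean_subordination_of_temperedStableClass (hG : IsInverseDensity Pr S G)
    (hS : IsSubordinatorOf Pr S k) (hk : IsKernel k) (hf : Measurable f)
    (hf0 : ∀ t, 0 < t → 0 ≤ f t) (hfi : IntegrableOn f (Ioi 0)) {θ β : ℝ} (hθ : 0 < θ)
    (hβ : 0 < β) (h : TemperedStableClass θ β k) :
    SubordinationConverges f G ∧ cesaroMean (subordination f G) ~[atTop]
      fun t => θ * β ^ (θ - 1) * laplace f 0 * t⁻¹ := by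
  refine cesaroMean_subordination_of_tendsto hG hS hk hf hf0 (C := θ * β ^ (θ - 1))
    (by positivity) hfi ?_ fun t => rfl
  -- the limit is the derivative of `l ↦ (l + β) ^ θ` at `0`
  have hd : HasDerivAt (fun l : ℝ => (l + β) ^ θ) (1 * θ * (0 + β) ^ (θ - 1)) 0 :=
    ((hasDerivAt_id (0 : ℝ)).add_const β).rpow_const (Or.inl (by simpa using hβ.ne'))
  have hs := hd.tendsto_slope_zero_right
  simp only [zero_add, one_mul, smul_eq_mul] at hs
  refine hs.congr' ?_
  filter_upwards [self_mem_nhdsWithin] with l hl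
  rw [h l hl]
  ring

end KernelClasses

/-! ### Passage to a solution of the Cauchy problem -/

/-- The subordination only involves the values of the function on `(0, ∞)`. -/
lemma subordination_congr {f g : ℝ → ℝ} (h : EqOn f g (Ioi 0)) (G : ℝ → ℝ → ℝ) :
    subordination f G = subordination g G :=
  funext fun t => setIntegral_congr_fun measurableSet_Ioi fun τ hτ => by simp only [h hτ]

lemma SubordinationConverges.congr {f g : ℝ → ℝ} {G : ℝ → ℝ → ℝ}
    (hf : SubordinationConverges f G) (h : EqOn f g (Ioi 0)) : SubordinationConverges g G := by
  refine ⟨hf.1.mono fun s hs => hs.congr_fun (fun τ hτ => by simp only [h hτ])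
    measurableSet_Ioi, ?_⟩
  rw [← subordination_congr h]
  exact hf.2

lemma laplace_congr {f g : ℝ → ℝ} (h : EqOn f g (Ioi 0)) (l : ℝ) : laplace f l = laplace g l :=
  setIntegral_congr_fun measurableSet_Ioi fun τ hτ => by simp only [h hτ]

lemma norm1_eq_laplace {f : ℝ → ℝ} (hf0 : ∀ t, 0 < t → 0 ≤ f t) : norm1 f = laplace f 0 :=
  setIntegral_congr_fun measurableSet_Ioi fun τ hτ => by
    simp [abs_of_nonneg (hf0 τ hτ)]

end Subord

theorem corollary1p3 {N : ℕ} (P : Subord.MarkovSemigroup (EuclideanSpace ℝ (Fin N)))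
    (φ : EuclideanSpace ℝ (Fin N) → ℝ) (hφ0 : ∀ y, 0 ≤ φ y) (hφ : Integrable φ)
    (v : EuclideanSpace ℝ (Fin N) → ℝ → ℝ) (hv : Subord.IsSolution P φ v)
    (hv0 : ∀ y t, 0 < t → 0 ≤ v y t)
    {Ω : Type*} [MeasurableSpace Ω] (Pr : Measure Ω) [IsProbabilityMeasure Pr]
    (k : ℝ → ℝ) (hk : Subord.IsKernel k)
    (S : ℝ≥0 → Ω → ℝ≥0∞) (hS : Subord.IsSubordinatorOf Pr S k)
    (G : ℝ → ℝ → ℝ) (hG : Subord.IsInverseDensity Pr S G)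
    (x : EuclideanSpace ℝ (Fin N)) :
    -- the θ-stable class
    (∀ θ : ℝ, 0 < θ → θ < 1 → Subord.StableClass θ k → IntegrableOn (v x) (Ioi 0) →
      Subord.SubordinationConverges (v x) G ∧
      Subord.cesaroMean (Subord.subordination (v x) G) ~[atTop]
        fun t => Subord.norm1 (v x) / Real.Gamma (2 - θ) * t ^ (-θ)) ∧
    -- the distributed order class
    (∀ C κ : ℝ, 0 < C → 0 < κ → Subord.DistributedOrderClass C κ k →
      IntegrableOn (v x) (Ioi 0) →
      Subord.SubordinationConverges (v x) G ∧
      Subord.cesaroMean (Subord.subordination (v x) G) ~[atTop]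
        fun t => C * Subord.norm1 (v x) * (Real.log t) ^ (-κ)) ∧
    -- the inverse Gamma class, positive first parameter: only the weighted norm has to be finite
    (∀ a b : ℝ, 0 < a → 0 < b → Subord.InverseGammaClass a b k →
      IntegrableOn (fun τ => Real.exp (-(√(a * b) * τ)) * v x τ) (Ioi 0) →
      Subord.SubordinationConverges (v x) G ∧
      Subord.cesaroMean (Subord.subordination (v x) G) ~[atTop]
        fun _ => √(a * b) * Subord.weightedNorm1 √(a * b) (v x)) ∧
    -- the inverse Gamma class, zero first parameter: a multiple of the 1/2-stable kernel
    (∀ b : ℝ, 0 < b → Subord.InverseGammaClass 0 b k → IntegrableOn (v x) (Ioi 0) →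
      Subord.SubordinationConverges (v x) G ∧
      Subord.cesaroMean (Subord.subordination (v x) G) ~[atTop]
        fun t => 2 * √(2 * b) * Subord.norm1 (v x) / Real.Gamma (3 / 2) * t ^ (-(1 / 2) : ℝ)) ∧
    -- the Gamma class
    (∀ a b : ℝ, 0 < a → 0 < b → Subord.GammaClass a b k → IntegrableOn (v x) (Ioi 0) →
      Subord.SubordinationConverges (v x) G ∧
      Subord.cesaroMean (Subord.subordination (v x) G) ~[atTop]
        fun t => a * Subord.norm1 (v x) / b * t⁻¹) ∧
    -- the tempered stable class
    (∀ θ β : ℝ, 0 < θ → θ < 1 → 0 < β → Subord.TemperedStableClass θ β k →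
      IntegrableOn (v x) (Ioi 0) →
      Subord.SubordinationConverges (v x) G ∧
      Subord.cesaroMean (Subord.subordination (v x) G) ~[atTop]
        fun t => θ * β ^ (θ - 1) * Subord.norm1 (v x) * t⁻¹) := by
  -- the orbit at `x` may behave badly at negative times: it is replaced by `0` off `(0, ∞)`
  have hcont : ContinuousOn (v x) (Ioi 0) := fun t ht => by
    obtain ⟨g, -, hg⟩ := hv.evolution t ht
    exact (hg x).continuousAt.continuousWithinAt
  have hf : Measurable ((Ioi (0 : ℝ)).indicator (v x)) := by
    rw [← piecewise_eq_indicator]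
    exact hcont.measurable_piecewise continuousOn_const measurableSet_Ioi
  have heq : EqOn ((Ioi (0 : ℝ)).indicator (v x)) (v x) (Ioi 0) :=
    fun t ht => indicator_of_mem ht _
  have hf0 : ∀ t, 0 < t → 0 ≤ (Ioi (0 : ℝ)).indicator (v x) t := fun t ht => by
    rw [heq ht]; exact hv0 x t ht
  have hnorm : Subord.laplace ((Ioi (0 : ℝ)).indicator (v x)) 0 = Subord.norm1 (v x) := by
    rw [Subord.laplace_congr heq, Subord.norm1_eq_laplace (hv0 x)]
  have hint : IntegrableOn (v x) (Ioi 0) →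
      IntegrableOn ((Ioi (0 : ℝ)).indicator (v x)) (Ioi 0) :=
    fun h => h.congr_fun heq.symm measurableSet_Ioi
  have hfin : ∀ {u : ℝ → ℝ}, (Subord.SubordinationConverges ((Ioi (0 : ℝ)).indicator (v x)) G ∧
        Subord.cesaroMean (Subord.subordination ((Ioi (0 : ℝ)).indicator (v x)) G) ~[atTop] u) →
      Subord.SubordinationConverges (v x) G ∧
        Subord.cesaroMean (Subord.subordination (v x) G) ~[atTop] u := fun h => by
    rw [Subord.subordination_congr heq] at h
    exact ⟨h.1.congr heq, h.2⟩
  refine ⟨fun θ hθ0 hθ1 hc hi => ?_, fun C κ hC hκ hc hi => ?_, fun a b ha hb hc hi => ?_,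
    fun b hb hc hi => ?_, fun a b ha hb hc hi => ?_, fun θ β hθ _ hβ hc hi => ?_⟩
  · rw [← hnorm]
    exact hfin (Subord.cesaroMean_subordination_of_stableClass hG hS hk hf hf0 (hint hi)
      hθ0 hθ1 hc)
  · rw [← hnorm]
    exact hfin (Subord.cesaroMean_subordination_of_distributedOrderClass hG hS hk hf hf0
      (hint hi) hC hκ hc)
  · have hw : Subord.weightedNorm1 √(a * b) (v x) =
        Subord.laplace ((Ioi (0 : ℝ)).indicator (v x)) √(a * b) :=
      (Subord.laplace_congr heq _).symm
    rw [hw]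
    exact hfin (Subord.cesaroMean_subordination_of_inverseGammaClass hG hS hk hf hf0 ha hb
      (hi.congr_fun (fun t ht => by simp only [heq ht]) measurableSet_Ioi) hc)
  · rw [← hnorm]
    exact hfin (Subord.cesaroMean_subordination_of_inverseGammaClass_zero hG hS hk hf hf0
      (hint hi) hb hc)
  · rw [← hnorm]
    exact hfin (Subord.cesaroMean_subordination_of_gammaClass hG hS hk hf hf0 (hint hi)
      ha hb hc)
  · rw [← hnorm]
    exact hfin (Subord.cesaroMean_subordination_of_temperedStableClass hG hS hk hf hf0
      (hint hi) hθ hβ hc)
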